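/- **Theorem 7.1.** Let $p>0$, $p\neq 1$, let $m\ge 0$ be an integer, and let $0=t_0<s_0<t_1<s_1<\dots<t_m<s_m=L$, $\mu_0,\dots,\mu_m>0$. Put $\tau_i=s_i-t_i$ ($0\le i\le m$) and $\varsigma_i=t_{i+1}-s_i$ ($0\le i\le m-1$), and let $a=\mu_i$ on $[t_i,s_i]$ and $a=0$ on $(s_i,t_{i+1})$. Let $\hat r_0,\hat r_L\subset\mathbb R^2$ be arcs from the origin to infinity (images of continuous injective curves $\gamma:[0,\infty)\to\mathbb R^2$ with $\gamma(0)=0$ and $|\gamma(\sigma)|\to\infty$), contained in closed quadrants $Q_0$ and $Q_L$ respectively, and consider the Sturm–Liouville problem $$-u''=a(t)|u|^{p-1}u\ \text{ in } [0,L],\qquad (u(0),u'(0))\in\hat r_0,\qquad (u(L),u'(L))\in\hat r_L ,\tag{P}$$ where a solution is a $C^1$ function $u$ on $[0,L]$ with $u'$ absolutely continuous satisfying the equation almost everywhere. For $c>0$ let $$x_{+,i}(c)=\Big(\frac{(p+1)c}{\mu_i}\Big)^{\frac1{p+1}},\qquad T_i(c)=4\int_0^1\frac{dr}{\sqrt{\frac{2\mu_i}{p+1}\,x_{+,i}(c)^{p-1}(1-r^{p+1})}}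 =4\,\mu_i^{-\frac1{p+1}}c^{\frac{1-p}{2(p+1)}}\frac{B(\frac1{p+1},\frac12)}{\sqrt2\,(p+1)^{\frac p{p+1}}}$$ ($B$ is the Euler beta function; $T_i(c)$ is the period of the orbit $\frac{y^2}{2}+\frac{\mu_i}{p+1}|x|^{p+1}=c$ of $x'=y$, $y'=-\mu_i|x|^{p-1}x$). Assume that for every $i\in\{0,\dots,m\}$ there are $d_i,e_i>0$ with $d_i\ne e_i$ and integers $0\le\alpha_i<\beta_i$ such that $$(\alpha_i+\tfrac12)T_i(d_i)>\tau_i>(\beta_i+\tfrac12)T_i(e_i)\quad (1\le i\le m-1),$$ $$(\alpha_i+\tfrac14)T_i(d_i)>\tau_i>(\beta_i+\tfrac12)T_i(e_i)\quad (i=0,m),$$ and that, with $c_{1,i}=\min\{d_i,e_i\}$ and $c_{2,i}=\max\{d_i,e_i\}$, $$\varsigma_i\ \ge\ \frac{x_{+,i}(c_{2,i})+x_{+,i+1}(c_{2,i+1})}{\sqrt{2\min\{c_{1,i},c_{1,i+1}\}}}\qquad (0\le i\le m-1).$$ Then (P) has at least $2^m\prod_{i=0}^m(\beta_i-\alpha_i)$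 solutions that are not identically zero. Moreover, let $\mathcal A_i=\{(x,y): c_{1,i}\le \frac{y^2}2+\frac{\mu_i}{p+1}|x|^{p+1}\le c_{2,i}\}$, let $I,II,III,IV$ denote the closed quadrants, and call *itinerary* a choice of $\kappa_i\in\{I,III\}$ for $1\le i\le m$ and of $j_i\in\{1,\dots,\beta_i-\alpha_i\}$ for $0\le i\le m$; there are $2^m\prod_i(\beta_i-\alpha_i)$ itineraries. Set $q_0=Q_0$, $q_i=\kappa_i$ for $i\ge1$, and $q'_m=Q_L$, while for $i<m$ put $q'_i=II$ if $\kappa_{i+1}=I$ and $q'_i=IV$ if $\kappa_{i+1}=III$. Then one can assign to every itinerary a solution $u$ of (P), different itineraries giving different solutions, such that: * for every $0\le i\le m$, $(u(t_i),u'(t_i))\in\mathcal A_i\cap q_i$ and $(u(s_i),u'(s_i))\in\mathcal A_i\cap q_i'$; * for every $0\le i\le m$, $u$ has exactly $2(\alpha_i+j_i)-2+o(q_i,q'_i)$ zeros in the interval with end points $t_i$ and $s_i$ which contains $t_i$ if and only if $q_i\in\{II,IV\}$, and contains $s_i$ if and only if $q_i'\in\{I,III\}$. Here $o(q,q')=1$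 for $(q,q')\in\{(I,III),(I,II),(III,I),(III,IV),(IV,II),(II,IV)\}$, $o(q,q')=3$ for $(q,q')\in\{(IV,III),(II,I)\}$, and $o(q,q')=2$ otherwise. In particular, for $1\le i\le m-1$, $u$ has exactly $2(\alpha_i+j_i)-1$ zeros in $(t_i,s_i)$ if $\kappa_i=\kappa_{i+1}$, and exactly $2(\alpha_i+j_i)$ if $\kappa_i\ne\kappa_{i+1}$; * for every $0\le i\le m-1$, $u$ has exactly one zero in $(s_i,t_{i+1})$, and $u'\ne0$ on $[s_i,t_{i+1}]$. -/

import Mathlib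

open Set Filter Topology MeasureTheory

namespace MooreNehari

/-- The four closed quadrants of the phase plane, numbered counterclockwise as usual. -/
inductive Quadrant
  | I | II | III | IV

/-- The closed quadrant as a set of points `(x, y)`. -/
def Quadrant.carrier : Quadrant → Set (ℝ × ℝ)
  | .I => {z | 0 ≤ z.1 ∧ 0 ≤ z.2}
  | .II => {z | z.1 ≤ 0 ∧ 0 ≤ z.2}
  | .III => {z | z.1 ≤ 0 ∧ z.2 ≤ 0}
  | .IV => {z | 0 ≤ z.1 ∧ z.2 ≤ 0}

/-- Unbounded arcs linking the origin to infinity: the image of a continuous injective curve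
`γ : [0, ∞) → ℝ²` with `γ 0 = 0` and `‖γ σ‖ → ∞` as `σ → ∞`. -/
def IsArcToInfinity (R : Set (ℝ × ℝ)) : Prop :=
  ∃ γ : ℝ → ℝ × ℝ, ContinuousOn γ (Ici 0) ∧ InjOn γ (Ici 0) ∧ γ 0 = 0 ∧
    Tendsto (fun σ => ‖γ σ‖) atTop atTop ∧ γ '' Ici 0 = R

/-- The stepwise weight: `μ i` on `[t i, s i]`, and zero elsewhere. -/
noncomputable def stepWeight {m : ℕ} (t s μ : Fin (m + 1) → ℝ) (x : ℝ) : ℝ :=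
  ∑ i, (Icc (t i) (s i)).indicator (fun _ => μ i) x

/-- `u` is a (Carathéodory) solution of `-u'' = a(x) |u|^(p-1) u` on `[0, L]`, with derivative `v`:
`u` is of class `C¹` with `u' = v`, `v` is absolutely continuous, and the equation holds almost
everywhere. -/
structure IsSolution (p : ℝ) (a : ℝ → ℝ) (L : ℝ) (u v : ℝ → ℝ) : Prop where
  hasDeriv : ∀ x ∈ Icc 0 L, HasDerivWithinAt u (v x) (Icc 0 L) x
  absCont : AbsolutelyContinuousOnInterval v 0 L
  equation : ∀ᵐ x ∂(volume.restrict (Icc 0 L)),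
    HasDerivAt v (-(a x * (|u x| ^ (p - 1) * u x))) x

/-- The boundary value problem: a solution whose phase point lies on `R₀` at time `0` and on
`RL` at time `L`. -/
def SolvesBVP (p : ℝ) (a : ℝ → ℝ) (L : ℝ) (R₀ RL : Set (ℝ × ℝ)) (u v : ℝ → ℝ) : Prop :=
  IsSolution p a L u v ∧ (u 0, v 0) ∈ R₀ ∧ (u L, v L) ∈ RL

/-- The energy of `x' = y`, `y' = -μ |x|^(p-1) x`. -/
noncomputable def energy (p μ : ℝ) (z : ℝ × ℝ) : ℝ :=
  z.2 ^ 2 / 2 + μ / (p + 1) * |z.1| ^ (p + 1)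

/-- The positive abscissa at which the energy level `c` meets the `x`-axis. -/
noncomputable def xPlus (p μ c : ℝ) : ℝ :=
  ((p + 1) * c / μ) ^ (1 / (p + 1))

/-- The period of the orbit of `x' = y`, `y' = -μ |x|^(p-1) x` through `(ξ, 0)`, `ξ > 0`. -/
noncomputable def period (p μ ξ : ℝ) : ℝ :=
  4 * ∫ r in (0 : ℝ)..1, 1 / √(2 * μ / (p + 1) * ξ ^ (p - 1) * (1 - r ^ (p + 1)))

/-- The closed annulus between the energy levels `min d e` and `max d e`. -/
def annulus (p μ d e : ℝ) : Set (ℝ × ℝ) :=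
  {z | min d e ≤ energy p μ z ∧ energy p μ z ≤ max d e}

/-- An itinerary: for each of the times `t₁, …, t_m`, the choice of the first quadrant (`true`) or
the third one (`false`), and, for each of the `m + 1` intervals `[t_i, s_i]`, an integer among
`n i` ones; `lap i = k` encodes the integer `j_i = k + 1` of `{1, …, n i}`. -/
structure Itinerary (m : ℕ) (n : Fin (m + 1) → ℕ) where
  entersFirst : Fin m → Bool
  lap : ∀ i : Fin (m + 1), Fin (n i)

namespace Itinerary

variable {m : ℕ} {n : Fin (m + 1) → ℕ}

/-- The quadrant at time `t i`: the prescribed `q₀` for `i = 0`, then the first or third one. -/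
def startQuadrant (ι : Itinerary m n) (q₀ : Quadrant) : Fin (m + 1) → Quadrant :=
  Fin.cases q₀ fun i => if ι.entersFirst i then .I else .III

/-- The quadrant at time `s i`: the prescribed `qL` for `i = m`; otherwise the second quadrant when
the itinerary goes on to the first one, and the fourth when it goes on to the third one. -/
def endQuadrant (ι : Itinerary m n) (qL : Quadrant) : Fin (m + 1) → Quadrant :=
  Fin.lastCases qL fun i => if ι.entersFirst i then .II else .IV

end Itinerary

/-- `offset q q'`: moving clockwise from the quadrant `q`, pass over the next one and go on to the
first quadrant equal to `q'`; this is the number of crossings of the `y`-axis met, where the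
`y`-axis is crossed on entering the first or third quadrant. -/
def offset : Quadrant → Quadrant → ℕ
  | .I, .III => 1
  | .I, .II => 1
  | .I, .I => 2
  | .I, .IV => 2
  | .III, .I => 1
  | .III, .IV => 1
  | .III, .III => 2
  | .III, .II => 2
  | .IV, .II => 1
  | .IV, .I => 2
  | .IV, .IV => 2
  | .IV, .III => 3
  | .II, .IV => 1
  | .II, .III => 2
  | .II, .II => 2
  | .II, .I => 3

/-- The interval between `T` and `S` on which zeros are counted: the open one, together with `T` if
the motion starts in the second or fourth quadrant (so that a zero of `x` at time `T` is a crossing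
of the `y`-axis still ahead) and with `S` if it ends in the first or third quadrant. -/
def countingInterval (q q' : Quadrant) (T S : ℝ) : Set ℝ :=
  {x | T ≤ x ∧ x ≤ S ∧ (x = T → q = .II ∨ q = .IV) ∧ (x = S → q' = .I ∨ q' = .III)}

/-- The nodal pattern of `u` (with `u' = v`) described by an itinerary: the regions visited at the
times `t i` and `s i`, the exact number of zeros of `u` on each interval `[t i, s i]`, and on each
gap `(s i, t (i+1))` exactly one zero of `u`, while `u'` does not vanish there. -/
structure Follows {m : ℕ} (p : ℝ) (t s μ d e : Fin (m + 1) → ℝ) (α β : Fin (m + 1) → ℕ)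
    (q₀ qL : Quadrant) (ι : Itinerary m fun i => β i - α i) (u v : ℝ → ℝ) : Prop where
  start_mem : ∀ i, (u (t i), v (t i)) ∈
    annulus p (μ i) (d i) (e i) ∩ (ι.startQuadrant q₀ i).carrier
  end_mem : ∀ i, (u (s i), v (s i)) ∈
    annulus p (μ i) (d i) (e i) ∩ (ι.endQuadrant qL i).carrier
  zeros : ∀ i, {x ∈ countingInterval (ι.startQuadrant q₀ i) (ι.endQuadrant qL i) (t i) (s i) |
      u x = 0}.encard =
    ((2 * (α i + ι.lap i) + offset (ι.startQuadrant q₀ i) (ι.endQuadrant qL i) : ℕ) : ℕ∞)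
  gap_zeros : ∀ i : Fin m, {x ∈ Ioo (s i.castSucc) (t i.succ) | u x = 0}.encard = 1
  gap_deriv : ∀ i : Fin m, ∀ x ∈ Icc (s i.castSucc) (t i.succ), v x ≠ 0

/-- The integral of `1 / √(1 - r^q)` over `[0, 1]` in terms of the beta function. -/
theorem integral_one_div_sqrt {q : ℝ} (hq : 0 < q) :
    ∫ r in (0 : ℝ)..1, 1 / √(1 - r ^ q) = ProbabilityTheory.beta (1 / q) (1 / 2) / q := by
  have hbeta : ProbabilityTheory.beta (1 / q) (1 / 2) =
      ∫ x in Ioo (0 : ℝ) 1, x ^ (1 / q - 1) * (1 - x) ^ ((1 : ℝ) / 2 - 1) := by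
    have hq' : 0 < 1 / q := by positivity
    rw [ProbabilityTheory.beta_eq_betaIntegralReal _ _ hq' (by norm_num), Complex.betaIntegral,
      intervalIntegral.integral_of_le (by norm_num), ← integral_Ioc_eq_integral_Ioo,
      ← RCLike.re_to_complex, ← integral_re]
    · refine setIntegral_congr_fun measurableSet_Ioc fun x ⟨hx1, hx2⟩ ↦ ?_
      norm_cast
      rw [← Complex.ofReal_cpow, ← Complex.ofReal_cpow, RCLike.re_to_complex,
        Complex.re_mul_ofReal, Complex.ofReal_re]
      all_goals linarith
    have h := Complex.betaIntegral_convergent (u := ((1 / q : ℝ) : ℂ)) (v := ((1 / 2 : ℝ) : ℂ))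
      (by simpa using hq) (by norm_num)
    rwa [intervalIntegrable_iff_integrableOn_Ioc_of_le (by simp), IntegrableOn] at h
  have key := integral_comp_rpow_Ioi_of_pos
    (g := (Ioo (0 : ℝ) 1).indicator fun r => 1 / √(1 - r ^ q)) (p := 1 / q) (by positivity)
  have hsub : Ioo (0 : ℝ) 1 ∩ Ioi 0 = Ioo 0 1 := by
    ext x; simp only [mem_inter_iff, mem_Ioo, mem_Ioi]; tauto
  rw [integral_indicator measurableSet_Ioo, Measure.restrict_restrict measurableSet_Ioo, hsub]
    at key
  rw [intervalIntegral.integral_of_le zero_le_one, integral_Ioc_eq_integral_Ioo, ← key,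
    div_eq_inv_mul (ProbabilityTheory.beta _ _), hbeta, ← integral_const_mul, ← hsub, ← Measure.restrict_restrict measurableSet_Ioo,
    ← integral_indicator measurableSet_Ioo]
  refine setIntegral_congr_fun measurableSet_Ioi fun x hx => ?_
  have hx0 : 0 < x := hx
  simp only [smul_eq_mul, hsub]
  by_cases h1 : x < 1
  · have hm : x ^ (1 / q) ∈ Ioo (0 : ℝ) 1 :=
      ⟨by positivity, Real.rpow_lt_one hx0.le h1 (by positivity)⟩
    rw [indicator_of_mem hm, indicator_of_mem (show x ∈ Ioo (0 : ℝ) 1 from ⟨hx0, h1⟩),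
      ← Real.rpow_mul hx0.le, one_div_mul_cancel hq.ne', Real.rpow_one, Real.sqrt_eq_rpow,
      one_div (_ ^ _), ← Real.rpow_neg (by linarith)]
    norm_num
    ring
  · have hm : x ^ (1 / q) ∉ Ioo (0 : ℝ) 1 := fun h =>
      absurd h.2 (not_lt.2 (Real.one_le_rpow (not_lt.1 h1) (by positivity)))
    rw [indicator_of_notMem hm, indicator_of_notMem (fun h => h1 h.2), mul_zero]

/-- The period of the orbit of energy `c` in terms of the beta function. -/
theorem period_eq {p μ c : ℝ} (hp : 0 < p) (hμ : 0 < μ) (hc : 0 < c) :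
    period p μ (xPlus p μ c) = 4 * (μ ^ (-1 / (p + 1)) * c ^ ((1 - p) / (2 * (p + 1))) *
      (ProbabilityTheory.beta (1 / (p + 1)) (1 / 2) / (√2 * (p + 1) ^ (p / (p + 1))))) := by
  have hq : 0 < p + 1 := by linarith
  unfold period xPlus
  set K := 2 * μ / (p + 1) * (((p + 1) * c / μ) ^ (1 / (p + 1))) ^ (p - 1) with hK
  have hK0 : 0 < K := by positivity
  have h1 : ∀ r : ℝ, 1 / √(K * (1 - r ^ (p + 1))) = 1 / √K * (1 / √(1 - r ^ (p + 1))) := by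
    intro r
    rw [Real.sqrt_mul hK0.le, one_div_mul_one_div]
  simp_rw [h1]
  rw [intervalIntegral.integral_const_mul, integral_one_div_sqrt hq]
  have hB : 0 < ProbabilityTheory.beta (1 / (p + 1)) (1 / 2) :=
    ProbabilityTheory.beta_pos (by positivity) (by norm_num)
  have hsq : 1 / √K = μ ^ (-1 / (p + 1)) * c ^ ((1 - p) / (2 * (p + 1))) *
      ((p + 1) / (√2 * (p + 1) ^ (p / (p + 1)))) := by
    have hR : 0 < μ ^ (-1 / (p + 1)) * c ^ ((1 - p) / (2 * (p + 1))) *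
      ((p + 1) / (√2 * (p + 1) ^ (p / (p + 1)))) := by positivity
    have hL : 0 < 1 / √K := by positivity
    refine Real.log_injOn_pos hL hR ?_
    rw [Real.log_mul (by positivity) (by positivity), Real.log_mul (by positivity) (by positivity),
      Real.log_div one_ne_zero (by positivity), Real.log_div (by positivity) (by positivity),
      Real.log_mul (by positivity) (by positivity), Real.log_sqrt hK0.le, Real.log_sqrt (by norm_num),
      Real.log_rpow hμ, Real.log_rpow hc, Real.log_rpow hq, hK,
      Real.log_mul (by positivity) (by positivity), Real.log_div (by positivity) (by positivity),
      Real.log_mul (by positivity) (by positivity), Real.log_rpow (by positivity),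
      Real.log_rpow (by positivity), Real.log_div (by positivity) (by positivity),
      Real.log_mul (by positivity) (by positivity), Real.log_one]
    field_simp
    ring
  rw [hsq]
  field_simp

end MooreNehari

open MooreNehari

/-! On an interval where the weight equals `μ i` the equation is autonomous: a phase point stays on
its energy level and, in a suitable angle (the uniform angle, a quarter turn having length `1`),
rotates clockwise with constant speed. On a gap it drifts freely, with constant `u'`. All solutions
are therefore written down explicitly and glued; no uniqueness theorem for the initial value problem
is needed.

The angular speed depends on the energy. The twist hypotheses say that at energy `d i` the point
turns too little to get past the beginning of any sector prescribed by an itinerary, and at energy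
`e i` it turns beyond the end of all of them (`TwistData.endAngle_le`, `TwistData.le_endAngle`). So
a path that crosses the annulus between these energies inside one quadrant is wound into a spiral,
and for each admissible number of laps a subpath of it sweeps the whole target quadrant, from one
axis to the other. If the target is the second or fourth quadrant, the length of the gap guarantees
that the drift carries this subpath to a path which again contains a crossing of the next annulus,
now inside the first or third quadrant (`exists_gap_crossing`).

Starting from a piece of the initial arc and repeating this along an itinerary, one obtains a path
across the last annulus made of phase points reached by partial solutions with the prescribed
history (`exists_prefix_path`). Its image under the last rotation sweeps the target sector, which
the final arc crosses from one energy level to the other; the two must meet (`exists_meeting`), by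
the planar Poincaré–Miranda theorem `exists_common_zero`. A meeting point is a solution of the
boundary value problem.

Angles are real numbers and not classes modulo a full turn, so laps are counted by integers. The
zeros of `u` are the times at which the angle is an even integer, which gives the exact counts in
`encard_zeros_gsin`. Quadrants and zero counts recover the itinerary from the solution
(`Follows.itinerary_eq`). -/

namespace MooreNehari

/-! ### Planar crossing theorem -/

/-- A continuous angle that stays in a half-plane cannot leave the half-turn in which it starts. -/
theorem sub_le_of_cos_nonneg_aux {h : ℝ → ℝ} (hh : Continuous h) {a : ℝ}
    (hc : ∀ x ∈ Icc (0 : ℝ) 1, 0 ≤ Real.cos (h x - a)) (h0 : |h 0 - a| ≤ Real.pi / 2) :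
    h 1 - a ≤ Real.pi / 2 := by
  by_contra! hlt
  have hpi := Real.pi_pos
  rw [abs_le] at h0
  -- This value is attained, and the cap at `a + π` keeps it in the window just above `a + π / 2`
  -- where the cosine is negative.
  have hw : min (h 1) (a + Real.pi) ∈ Icc (h 0) (h 1) :=
    ⟨le_min (by linarith) (by linarith), min_le_left _ _⟩
  obtain ⟨x, hx, hxe⟩ := intermediate_value_Icc zero_le_one hh.continuousOn hw
  have h2 : h x ≤ a + Real.pi := by simp [hxe]
  have h3 : a + Real.pi / 2 < h x := by rw [hxe]; exact lt_min (by linarith) (by linarith)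
  have := Real.cos_neg_of_pi_div_two_lt_of_lt (x := h x - a) (by linarith) (by linarith)
  linarith [hc x hx]

theorem abs_sub_le_of_cos_nonneg {h : ℝ → ℝ} (hh : Continuous h) {a : ℝ}
    (hc : ∀ x ∈ Icc (0 : ℝ) 1, 0 ≤ Real.cos (h x - a)) (h0 : |h 0 - a| ≤ Real.pi / 2) :
    |h 1 - a| ≤ Real.pi / 2 := by
  have h1 := sub_le_of_cos_nonneg_aux hh hc h0
  have h2 := sub_le_of_cos_nonneg_aux (h := fun x => -h x) (a := -a) hh.neg
    (fun x hx => by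
      rw [← Real.cos_neg, show -(-h x - -a) = h x - a by ring]; exact hc x hx)
    (by rw [← abs_neg, show -(-h 0 - -a) = h 0 - a by ring]; exact h0)
  rw [abs_le]; constructor <;> linarith

/-- The plane is simply connected, so a map into the punctured plane lifts through the covering
`Complex.exp`; the imaginary part of the lift is a continuous argument. -/
theorem exists_polar_lift {f g : ℝ × ℝ → ℝ} (hf : Continuous f) (hg : Continuous g)
    (hne : ∀ z, ¬ (f z = 0 ∧ g z = 0)) :
    ∃ ρ A : ℝ × ℝ → ℝ, Continuous A ∧ (∀ z, 0 < ρ z) ∧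
      ∀ z, f z = ρ z * Real.cos (A z) ∧ g z = ρ z * Real.sin (A z) := by
  have hF : ∀ z, (⟨f z, g z⟩ : ℂ) ≠ 0 := fun z h =>
    hne z ⟨congrArg Complex.re h, congrArg Complex.im h⟩
  let F : C(ℝ × ℝ, {z : ℂ // z ≠ 0}) := ⟨fun z => ⟨⟨f z, g z⟩, hF z⟩, by
    refine Continuous.subtype_mk ?_ _
    have : (fun z => (⟨f z, g z⟩ : ℂ)) = fun z => (f z : ℂ) + (g z : ℂ) * Complex.I := by
      funext z; apply Complex.ext <;> simp
    rw [this]; fun_prop⟩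
  obtain ⟨G, ⟨-, hG⟩, -⟩ := Complex.isCoveringMap_exp.existsUnique_continuousMap_lifts F (0, 0)
    (Complex.log ⟨f (0, 0), g (0, 0)⟩) (Subtype.ext (Complex.exp_log (hF _)))
  refine ⟨fun z => Real.exp (G z).re, fun z => (G z).im,
    Complex.continuous_im.comp G.continuous, fun z => Real.exp_pos _, fun z => ?_⟩
  have h : Complex.exp (G z) = ⟨f z, g z⟩ := congrArg Subtype.val (congrFun hG z)
  have h1 := congrArg Complex.re h
  have h2 := congrArg Complex.im h
  rw [Complex.exp_re] at h1
  rw [Complex.exp_im] at h2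
  exact ⟨h1.symm, h2.symm⟩

/-- A two-dimensional Poincaré–Miranda theorem for a pair of functions on the plane. -/
theorem exists_common_zero {f g : ℝ × ℝ → ℝ} (hf : Continuous f) (hg : Continuous g)
    (hf0 : ∀ y, f (0, y) ≤ 0) (hf1 : ∀ y, 0 ≤ f (1, y))
    (hg0 : ∀ x, g (x, 0) ≤ 0) (hg1 : ∀ x, 0 ≤ g (x, 1)) :
    ∃ z, f z = 0 ∧ g z = 0 := by
  -- Without a common zero, `(f, g)` has a continuous argument. Each side of the square is mapped
  -- into a half-plane, so the argument at `(1, 1)` can be bounded along the two ways from `(0, 0)`: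
  -- it is at most `-π` by the left and top sides, at least `-π / 2` by the bottom and right sides.
  by_contra! hne
  obtain ⟨ρ, A, hA, hρ, hfg⟩ := exists_polar_lift hf hg (fun z h => hne z h.1 h.2)
  have hpi := Real.pi_pos
  have cosle : ∀ z, f z ≤ 0 → Real.cos (A z) ≤ 0 := fun z h => by
    rw [(hfg z).1] at h; exact nonpos_of_mul_nonpos_right h (hρ z)
  have cosge : ∀ z, 0 ≤ f z → 0 ≤ Real.cos (A z) := fun z h => by
    rw [(hfg z).1] at h; exact nonneg_of_mul_nonneg_right h (hρ z)
  have sinle : ∀ z, g z ≤ 0 → Real.sin (A z) ≤ 0 := fun z h => by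
    rw [(hfg z).2] at h; exact nonpos_of_mul_nonpos_right h (hρ z)
  have singe : ∀ z, 0 ≤ g z → 0 ≤ Real.sin (A z) := fun z h => by
    rw [(hfg z).2] at h; exact nonneg_of_mul_nonneg_right h (hρ z)
  obtain ⟨n, hn⟩ : ∃ n : ℤ, A (0, 0) - n * (2 * Real.pi) ∈ Ico (-(3 / 2 * Real.pi)) (Real.pi / 2) := by
    obtain ⟨n, hn, -⟩ := existsUnique_sub_zsmul_mem_Ico (show 0 < 2 * Real.pi by linarith)
      (A (0, 0)) (-(3 / 2 * Real.pi))
    refine ⟨n, ?_⟩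
    rwa [zsmul_eq_mul, show -(3 / 2 * Real.pi) + 2 * Real.pi = Real.pi / 2 by ring] at hn
  let B : ℝ × ℝ → ℝ := fun z => A z - n * (2 * Real.pi)
  have hB : Continuous B := hA.sub continuous_const
  have hcB : ∀ z, Real.cos (B z) = Real.cos (A z) := fun z => Real.cos_sub_int_mul_two_pi _ _
  have hsB : ∀ z, Real.sin (B z) = Real.sin (A z) := fun z => Real.sin_sub_int_mul_two_pi _ _
  have hn1 : -(3 / 2 * Real.pi) ≤ B (0, 0) := hn.1
  have hn2 : B (0, 0) < Real.pi / 2 := hn.2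
  -- the lower left corner
  have c1 : B (0, 0) ≤ -(Real.pi / 2) := by
    by_contra! h
    have := Real.cos_pos_of_mem_Ioo ⟨h, hn2⟩
    linarith [hcB (0, 0), cosle _ (hf0 0)]
  have c2 : -Real.pi ≤ B (0, 0) := by
    by_contra! h
    have := Real.sin_pos_of_pos_of_lt_pi (x := B (0, 0) + 2 * Real.pi) (by linarith) (by linarith)
    rw [Real.sin_add_two_pi] at this
    linarith [hsB (0, 0), sinle _ (hg0 0)]
  have left := abs_sub_le_of_cos_nonneg (h := fun y => B (0, y)) (a := -Real.pi) (by fun_prop)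
    (fun y _ => by
      rw [sub_neg_eq_add, Real.cos_add_pi, hcB]; linarith [cosle _ (hf0 y)])
    (by rw [abs_le]; constructor <;> linarith)
  rw [abs_le] at left
  have c3 : B (0, 1) ≤ -Real.pi := by
    by_contra! h
    have := Real.sin_neg_of_neg_of_neg_pi_lt (x := B (0, 1)) (by linarith) h
    linarith [hsB (0, 1), singe _ (hg1 0)]
  have top := abs_sub_le_of_cos_nonneg (h := fun x => B (x, 1)) (a := -(3 / 2 * Real.pi))
    (by fun_prop)
    (fun x _ => by
      rw [show B (x, 1) - -(3 / 2 * Real.pi) = B (x, 1) - Real.pi / 2 + 2 * Real.pi by ring,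
        Real.cos_add_two_pi, Real.cos_sub_pi_div_two, hsB]
      exact singe _ (hg1 x))
    (by rw [abs_le]; constructor <;> linarith)
  rw [abs_le] at top
  have bottom := abs_sub_le_of_cos_nonneg (h := fun x => B (x, 0)) (a := -(Real.pi / 2))
    (by fun_prop)
    (fun x _ => by
      rw [sub_neg_eq_add, Real.cos_add_pi_div_two, hsB]; linarith [sinle _ (hg0 x)])
    (by rw [abs_le]; constructor <;> linarith)
  rw [abs_le] at bottom
  have c4 : -(Real.pi / 2) ≤ B (1, 0) := by
    by_contra! h
    have := Real.cos_neg_of_pi_div_two_lt_of_lt (x := -B (1, 0)) (by linarith) (by linarith)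
    rw [Real.cos_neg] at this
    linarith [hcB (1, 0), cosge _ (hf1 0)]
  have right := abs_sub_le_of_cos_nonneg (h := fun y => B (1, y)) (a := 0) (by fun_prop)
    (fun y _ => by rw [sub_zero, hcB]; exact cosge _ (hf1 y))
    (by rw [abs_le]; constructor <;> linarith)
  rw [abs_le] at right
  linarith

/-! ### Reparametrisation of paths -/

theorem exists_reparam_of_le {g : ℝ → ℝ} {x₀ x₁ : ℝ} (hx : x₀ ≤ x₁)
    (hg : ContinuousOn g (Icc x₀ x₁)) {a b : ℝ} (hab : a ≤ b)
    (h0 : g x₀ ≤ a) (h1 : b ≤ g x₁) :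
    ∃ r : ℝ → ℝ, Continuous r ∧ g (r 0) = a ∧ g (r 1) = b ∧
      ∀ σ, r σ ∈ Icc x₀ x₁ ∧ g (r σ) ∈ Icc a b := by
  -- the first time the level `b` is reached
  obtain ⟨y, hy, hyb⟩ := intermediate_value_Icc hx hg ⟨h0.trans hab, h1⟩
  have hK1 : IsCompact (Icc x₀ x₁ ∩ g ⁻¹' Ici b) :=
    isCompact_Icc.of_isClosed_subset (hg.preimage_isClosed_of_isClosed isClosed_Icc isClosed_Ici)
      inter_subset_left
  obtain ⟨τ, ⟨hτ, hτb⟩, hτmin⟩ := hK1.exists_isLeast ⟨y, hy, hyb.ge⟩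
  have hg' : ContinuousOn g (Icc x₀ τ) := hg.mono (Icc_subset_Icc_right hτ.2)
  -- After the last time `ρ` before `τ` at which `g ≤ a`, and before the first time `τ` at which `g
  -- ≥ b`, the values stay between `a` and `b`.
  have hK2 : IsCompact (Icc x₀ τ ∩ g ⁻¹' Iic a) :=
    isCompact_Icc.of_isClosed_subset (hg'.preimage_isClosed_of_isClosed isClosed_Icc isClosed_Iic)
      inter_subset_left
  obtain ⟨ρ, ⟨hρ, hρa⟩, hρmax⟩ := hK2.exists_isGreatest ⟨x₀, left_mem_Icc.2 hτ.1, h0⟩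
  have hτb' : g τ = b := by
    refine le_antisymm ?_ hτb
    by_contra! hlt
    obtain ⟨w, hw, hwb⟩ := intermediate_value_Icc hτ.1 hg' ⟨h0.trans hab, hlt.le⟩
    have : τ ≤ w := hτmin ⟨⟨hw.1, hw.2.trans hτ.2⟩, hwb.ge⟩
    rw [le_antisymm hw.2 this] at hwb
    linarith
  have hρa' : g ρ = a := by
    refine le_antisymm hρa ?_
    by_contra! hlt
    obtain ⟨w, hw, hwa⟩ := intermediate_value_Icc hρ.2 (hg'.mono (Icc_subset_Icc_left hρ.1))
      ⟨hlt.le, hab.trans hτb⟩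
    have : w ≤ ρ := hρmax ⟨⟨hρ.1.trans hw.1, hw.2⟩, hwa.le⟩
    rw [le_antisymm this hw.1] at hwa
    linarith
  -- Clamping the parameter to `[0, 1]` makes the path defined and confined for every real `σ`, so
  -- later paths need no domain.
  refine ⟨fun σ => ρ + (τ - ρ) * max 0 (min 1 σ), by fun_prop, by simpa using hρa',
    by simpa using hτb', fun σ => ?_⟩
  have e0 : 0 ≤ max 0 (min 1 σ) := le_max_left _ _
  have e1 : max 0 (min 1 σ) ≤ 1 := max_le zero_le_one (min_le_left _ _)
  set ε := max 0 (min 1 σ)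
  have hz1 : ρ ≤ ρ + (τ - ρ) * ε := by nlinarith [hρ.2]
  have hz2 : ρ + (τ - ρ) * ε ≤ τ := by nlinarith [hρ.2]
  change (ρ + (τ - ρ) * ε) ∈ Icc x₀ x₁ ∧ g (ρ + (τ - ρ) * ε) ∈ Icc a b
  generalize ρ + (τ - ρ) * ε = z at hz1 hz2 ⊢
  refine ⟨⟨hρ.1.trans hz1, hz2.trans hτ.2⟩, ?_, ?_⟩
  · by_contra! hlt
    have : z ≤ ρ := hρmax ⟨⟨hρ.1.trans hz1, hz2⟩, hlt.le⟩
    rw [le_antisymm this hz1] at hlt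
    linarith
  · by_contra! hlt
    have : τ ≤ z := hτmin ⟨⟨hρ.1.trans hz1, hz2.trans hτ.2⟩, hlt.le⟩
    rw [le_antisymm hz2 this] at hlt
    linarith

/-- Extract from a path on which a function passes from below `min a b` to above `max a b` a
subpath on which it goes from `a` to `b` while staying between them. -/
theorem exists_reparam {g : ℝ → ℝ} {x₀ x₁ : ℝ} (hx : x₀ ≤ x₁)
    (hg : ContinuousOn g (Icc x₀ x₁)) {a b : ℝ}
    (h0 : g x₀ ≤ min a b) (h1 : max a b ≤ g x₁) :
    ∃ r : ℝ → ℝ, Continuous r ∧ g (r 0) = a ∧ g (r 1) = b ∧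
      ∀ σ, r σ ∈ Icc x₀ x₁ ∧ g (r σ) ∈ Icc (min a b) (max a b) := by
  rcases le_total a b with h | h
  · rw [min_eq_left h] at *
    rw [max_eq_right h] at *
    exact exists_reparam_of_le hx hg h h0 h1
  · rw [min_eq_right h] at *
    rw [max_eq_left h] at *
    obtain ⟨r, hr, r0, r1, hr2⟩ := exists_reparam_of_le hx hg h h0 h1
    exact ⟨fun σ => r (1 - σ), by fun_prop, by simpa using r1, by simpa using r0,
      fun σ => hr2 _⟩

/-! ### Signed powers -/

/-- Odd powers compose by multiplying exponents; at `0` the factor `x` hides the conventional value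
of `|0| ^ (a - 1)`. -/
theorem abs_rpow_sub_one_mul_comp {a b x : ℝ} :
    |(|x| ^ (a - 1) * x)| ^ (b - 1) * (|x| ^ (a - 1) * x) = |x| ^ (a * b - 1) * x := by
  rcases eq_or_ne x 0 with rfl | hx
  · simp
  have hx' : 0 < |x| := abs_pos.2 hx
  have h1 : |(|x| ^ (a - 1) * x)| = |x| ^ a := by
    rw [abs_mul, abs_of_nonneg (by positivity), Real.rpow_sub_one hx'.ne', div_mul_cancel₀ _ hx'.ne']
  rw [h1, ← Real.rpow_mul hx'.le, ← mul_assoc, ← Real.rpow_add hx']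
  ring_nf

theorem abs_abs_rpow_sub_one_mul {a x : ℝ} (ha : 0 < a) : |(|x| ^ (a - 1) * x)| = |x| ^ a := by
  rcases eq_or_ne x 0 with rfl | hx
  · simp [ha.ne']
  have hx' : 0 < |x| := abs_pos.2 hx
  rw [abs_mul, abs_of_nonneg (by positivity), Real.rpow_sub_one hx'.ne', div_mul_cancel₀ _ hx'.ne']

theorem continuous_abs_rpow_sub_one_mul {a : ℝ} (ha : 0 < a) :
    Continuous fun x : ℝ => |x| ^ (a - 1) * x := by
  rw [continuous_iff_continuousAt]
  intro x
  rcases eq_or_ne x 0 with rfl | hx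
  · rw [ContinuousAt, mul_zero, tendsto_zero_iff_abs_tendsto_zero]
    have : (abs ∘ fun x : ℝ => |x| ^ (a - 1) * x) = fun x : ℝ => |x| ^ a := by
      funext y; exact abs_abs_rpow_sub_one_mul ha
    rw [this]
    have h := (continuous_abs.continuousAt (x := (0 : ℝ))).rpow_const (p := a) (Or.inr ha.le)
    simpa [ContinuousAt, ha.ne'] using h
  · exact ((continuous_abs.continuousAt).rpow_const (Or.inl (abs_pos.2 hx).ne')).mul continuousAt_id

theorem hasDerivAt_abs_rpow_sub_one_mul {a x : ℝ} (hx : x ≠ 0) :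
    HasDerivAt (fun x : ℝ => |x| ^ (a - 1) * x) (a * |x| ^ (a - 1)) x := by
  rcases lt_or_gt_of_ne hx with h | h
  · have h1 : HasDerivAt (fun y : ℝ => -((-y) ^ a)) (a * |x| ^ (a - 1)) x := by
      have := (((hasDerivAt_id' x).fun_neg).rpow_const (p := a) (Or.inl (neg_ne_zero.2 hx))).fun_neg
      refine this.congr_deriv ?_
      rw [abs_of_neg h]; simp
    refine h1.congr_of_eventuallyEq ?_
    filter_upwards [Iio_mem_nhds h] with y (hy : y < 0)
    rw [abs_of_neg hy, Real.rpow_sub_one (by linarith)]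
    have := hy.ne
    field_simp
  · have h1 : HasDerivAt (fun y : ℝ => y ^ a) (a * |x| ^ (a - 1)) x := by
      rw [abs_of_pos h]
      exact Real.hasDerivAt_rpow_const (Or.inl hx)
    refine h1.congr_of_eventuallyEq ?_
    filter_upwards [Ioi_mem_nhds h] with y (hy : 0 < y)
    rw [abs_of_pos hy, Real.rpow_sub_one hy.ne']
    field_simp

/-! ### The uniform angle -/

/-- Density of the uniform angle (proportional to time along an orbit) with respect to the polar
angle measured in the coordinates in which the orbits are circles. -/
noncomputable def turnDensity (q φ : ℝ) : ℝ := |Real.sin φ| ^ (2 / q - 1)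

/-- The integral of `turnDensity` over a quarter turn. -/
noncomputable def quarterTurn (q : ℝ) : ℝ := ∫ φ in (0 : ℝ)..(Real.pi / 2), turnDensity q φ

theorem image_sin_rpow {q : ℝ} (hq : 0 < q) :
    (fun φ => Real.sin φ ^ (2 / q)) '' Ioo 0 (Real.pi / 2) = Ioo 0 1 := by
  ext r
  constructor
  · rintro ⟨φ, ⟨h0, h1⟩, rfl⟩
    have hs : 0 < Real.sin φ := Real.sin_pos_of_pos_of_lt_pi h0 (by linarith [Real.pi_pos])
    have hs1 : Real.sin φ < 1 := by
      rw [← Real.sin_pi_div_two]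
      exact Real.sin_lt_sin_of_lt_of_le_pi_div_two (by linarith [Real.pi_pos]) le_rfl h1
    exact ⟨by positivity, Real.rpow_lt_one hs.le hs1 (by positivity)⟩
  · rintro ⟨h0, h1⟩
    have hr0 : 0 < r ^ (q / 2) := by positivity
    have hr1 : r ^ (q / 2) < 1 := Real.rpow_lt_one h0.le h1 (by positivity)
    refine ⟨Real.arcsin (r ^ (q / 2)), ⟨Real.arcsin_pos.2 hr0, Real.arcsin_lt_pi_div_two.2 hr1⟩, ?_⟩
    simp only
    rw [Real.sin_arcsin (by linarith) hr1.le, ← Real.rpow_mul h0.le]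
    field_simp
    simp

/-- The substitution `r = sin φ ^ (2 / q)` turns `1 - r ^ q` into `cos φ ^ 2`. -/
theorem sin_rpow_substitution {q : ℝ} (hq : 0 < q) :
    IntegrableOn (turnDensity q) (Ioo 0 (Real.pi / 2)) ∧
      ∫ φ in Ioo 0 (Real.pi / 2), turnDensity q φ =
        q / 2 * ∫ r in Ioo (0 : ℝ) 1, 1 / √(1 - r ^ q) := by
  have hd : ∀ φ ∈ Ioo 0 (Real.pi / 2), HasDerivWithinAt (fun φ => Real.sin φ ^ (2 / q))
      (Real.cos φ * (2 / q) * Real.sin φ ^ (2 / q - 1)) (Ioo 0 (Real.pi / 2)) φ := by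
    intro φ hφ
    have hs : 0 < Real.sin φ := Real.sin_pos_of_pos_of_lt_pi hφ.1 (by linarith [Real.pi_pos, hφ.2])
    exact ((Real.hasDerivAt_sin φ).rpow_const (Or.inl hs.ne')).hasDerivWithinAt
  have hinj : InjOn (fun φ => Real.sin φ ^ (2 / q)) (Ioo 0 (Real.pi / 2)) := by
    intro φ hφ ψ hψ h
    have hs : 0 < Real.sin φ := Real.sin_pos_of_pos_of_lt_pi hφ.1 (by linarith [Real.pi_pos, hφ.2])
    have hs' : 0 < Real.sin ψ := Real.sin_pos_of_pos_of_lt_pi hψ.1 (by linarith [Real.pi_pos, hψ.2])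
    have := Real.rpow_left_injOn (x := 2 / q) (by positivity) hs.le hs'.le h
    exact Real.injOn_sin ⟨by linarith [Real.pi_pos, hφ.1], hφ.2.le⟩
      ⟨by linarith [Real.pi_pos, hψ.1], hψ.2.le⟩ this
  have heq : EqOn (fun φ => |Real.cos φ * (2 / q) * Real.sin φ ^ (2 / q - 1)| •
      (1 / √(1 - (Real.sin φ ^ (2 / q)) ^ q))) (fun φ => 2 / q * turnDensity q φ)
      (Ioo 0 (Real.pi / 2)) := by
    intro φ hφ
    have hs : 0 < Real.sin φ := Real.sin_pos_of_pos_of_lt_pi hφ.1 (by linarith [Real.pi_pos, hφ.2])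
    have hc : 0 < Real.cos φ := Real.cos_pos_of_mem_Ioo ⟨by linarith [Real.pi_pos, hφ.1], hφ.2⟩
    have h1 : √(1 - (Real.sin φ ^ (2 / q)) ^ q) = Real.cos φ := by
      rw [← Real.rpow_mul hs.le, div_mul_cancel₀ _ hq.ne', Real.rpow_two, ← Real.cos_sq',
        Real.sqrt_sq hc.le]
    simp only [smul_eq_mul, h1, turnDensity]
    rw [abs_of_pos (by positivity), abs_of_pos hs]
    field_simp
  have hint := integrableOn_image_iff_integrableOn_abs_deriv_smul measurableSet_Ioo hd hinj
    (fun r => 1 / √(1 - r ^ q))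
  have hval := integral_image_eq_integral_abs_deriv_smul measurableSet_Ioo hd hinj
    (fun r => 1 / √(1 - r ^ q))
  rw [image_sin_rpow hq] at hint hval
  rw [integrableOn_congr_fun heq measurableSet_Ioo] at hint
  rw [setIntegral_congr_fun measurableSet_Ioo heq, integral_const_mul] at hval
  have hpos : 0 < ∫ r in Ioo (0 : ℝ) 1, 1 / √(1 - r ^ q) := by
    have := integral_one_div_sqrt hq
    rw [intervalIntegral.integral_of_le zero_le_one, integral_Ioc_eq_integral_Ioo] at this
    rw [this]
    exact div_pos (ProbabilityTheory.beta_pos (by positivity) (by norm_num)) hq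
  -- The integral of a non-integrable function is `0` by convention, so the positive value found
  -- through the beta function proves integrability.
  have h2 := hint.1 (by
    by_contra h
    rw [integral_undef h] at hpos
    exact lt_irrefl _ hpos)
  refine ⟨?_, ?_⟩
  · have := h2.const_mul (q / 2)
    refine (integrableOn_congr_fun (fun φ _ => ?_) measurableSet_Ioo).1 this
    field_simp
  · rw [hval]
    field_simp

theorem quarterTurn_eq {q : ℝ} (hq : 0 < q) :
    quarterTurn q = q / 2 * ∫ r in (0 : ℝ)..1, 1 / √(1 - r ^ q) := by
  rw [quarterTurn, intervalIntegral.integral_of_le (by positivity), integral_Ioc_eq_integral_Ioo,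
    (sin_rpow_substitution hq).2, intervalIntegral.integral_of_le zero_le_one,
    integral_Ioc_eq_integral_Ioo]

theorem quarterTurn_pos {q : ℝ} (hq : 0 < q) : 0 < quarterTurn q := by
  rw [quarterTurn_eq hq, integral_one_div_sqrt hq]
  have := ProbabilityTheory.beta_pos (α := 1 / q) (β := 1 / 2) (by positivity) (by norm_num)
  positivity

theorem turnDensity_periodic (q : ℝ) : Function.Periodic (turnDensity q) Real.pi := by
  intro φ
  simp [turnDensity, Real.sin_add_pi]

theorem turnDensity_pi_sub (q φ : ℝ) : turnDensity q (Real.pi - φ) = turnDensity q φ := by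
  simp [turnDensity, Real.sin_pi_sub]

theorem turnDensity_intervalIntegrable {q : ℝ} (hq : 0 < q) (a b : ℝ) :
    IntervalIntegrable (turnDensity q) volume a b := by
  have h1 : IntervalIntegrable (turnDensity q) volume 0 (Real.pi / 2) := by
    rw [intervalIntegrable_iff_integrableOn_Ioo_of_le (by positivity)]
    exact (sin_rpow_substitution hq).1
  have h2 : IntervalIntegrable (turnDensity q) volume (Real.pi / 2) Real.pi := by
    have := (h1.comp_sub_left Real.pi).symm
    simp only [turnDensity_pi_sub, sub_zero] at this
    convert this using 1
    ring
  exact (turnDensity_periodic q).intervalIntegrable₀ Real.pi_pos.ne' (h1.trans h2) a b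

/-- The uniform angle, normalised so that a quarter turn has length `1`, as a function of the polar
angle. -/
noncomputable def turn (q φ : ℝ) : ℝ := (∫ ψ in (0 : ℝ)..φ, turnDensity q ψ) / quarterTurn q

theorem continuous_turn {q : ℝ} (hq : 0 < q) : Continuous (turn q) :=
  (intervalIntegral.continuous_primitive (turnDensity_intervalIntegrable hq) 0).div_const _

/-- The density is nonnegative and positive off the zeros of the sine, which form a countable set.
-/
theorem strictMono_turn {q : ℝ} (hq : 0 < q) : StrictMono (turn q) := by
  intro a b hab
  unfold turn
  refine div_lt_div_of_pos_right ?_ (quarterTurn_pos hq)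
  have hI := turnDensity_intervalIntegrable hq
  rw [← sub_pos, intervalIntegral.integral_interval_sub_left (hI _ _) (hI _ _)]
  rw [intervalIntegral.integral_pos_iff_support_of_nonneg_ae
    (Eventually.of_forall fun x => by unfold turnDensity; positivity) (hI _ _)]
  refine ⟨hab, ?_⟩
  have hnull : volume {x : ℝ | Real.sin x = 0} = 0 := by
    refine (Set.Countable.mono ?_ (countable_range fun n : ℤ => (n : ℝ) * Real.pi)).measure_zero _
    intro x hx
    obtain ⟨n, hn⟩ := Real.sin_eq_zero_iff.1 hx
    exact ⟨n, hn⟩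
  have hsub : Ioc a b \ {x : ℝ | Real.sin x = 0} ⊆ Function.support (turnDensity q) ∩ Ioc a b := by
    rintro x ⟨hx, hs⟩
    exact ⟨(Real.rpow_pos_of_pos (abs_pos.2 hs) _).ne', hx⟩
  refine lt_of_lt_of_le ?_ (measure_mono hsub)
  rw [measure_sdiff_null hnull, Real.volume_Ioc]
  simpa using hab

theorem turn_zero (q : ℝ) : turn q 0 = 0 := by simp [turn]

theorem turn_pi_div_two {q : ℝ} (hq : 0 < q) : turn q (Real.pi / 2) = 1 :=
  div_self (quarterTurn_pos hq).ne'

theorem turn_pi {q : ℝ} (hq : 0 < q) : turn q Real.pi = 2 := by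
  have hI := turnDensity_intervalIntegrable hq
  have h := intervalIntegral.integral_comp_sub_left (a := Real.pi / 2) (b := Real.pi)
    (turnDensity q) Real.pi
  simp only [turnDensity_pi_sub, sub_self, show Real.pi - Real.pi / 2 = Real.pi / 2 by ring] at h
  unfold turn
  rw [← intervalIntegral.integral_add_adjacent_intervals (hI 0 (Real.pi / 2)) (hI _ _), h, ← two_mul]
  exact mul_div_cancel_right₀ _ (quarterTurn_pos hq).ne'

theorem turn_add_pi {q : ℝ} (hq : 0 < q) (φ : ℝ) : turn q (φ + Real.pi) = turn q φ + 2 := by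
  have hI := turnDensity_intervalIntegrable hq
  rw [← turn_pi hq]
  unfold turn
  rw [← add_div, ← intervalIntegral.integral_add_adjacent_intervals (hI 0 φ) (hI _ _),
    (turnDensity_periodic q).intervalIntegral_add_eq φ 0, zero_add]

theorem hasDerivAt_turn {q φ : ℝ} (hq : 0 < q) (hφ : Real.sin φ ≠ 0) :
    HasDerivAt (turn q) (turnDensity q φ / quarterTurn q) φ := by
  have hI := turnDensity_intervalIntegrable hq
  refine HasDerivAt.div_const ?_ _
  have hm : Measurable (turnDensity q) := by unfold turnDensity; fun_prop
  refine intervalIntegral.integral_hasDerivAt_right (hI _ _)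
    hm.stronglyMeasurable.stronglyMeasurableAtFilter ?_
  exact (Real.continuous_sin.abs.continuousAt).rpow_const (Or.inl (abs_pos.2 hφ).ne')

theorem surjective_turn {q : ℝ} (hq : 0 < q) : Function.Surjective (turn q) := by
  have h : ∀ n : ℕ, turn q (n * Real.pi) = 2 * n ∧ turn q (-(n * Real.pi)) = -(2 * n) := by
    intro n
    induction n with
    | zero => simp [turn_zero]
    | succ n ih =>
      constructor
      · rw [show ((n + 1 : ℕ) : ℝ) * Real.pi = n * Real.pi + Real.pi by push_cast; ring,
          turn_add_pi hq, ih.1]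
        push_cast; ring
      · have := turn_add_pi hq (-(((n + 1 : ℕ) : ℝ) * Real.pi))
        rw [show -(((n + 1 : ℕ) : ℝ) * Real.pi) + Real.pi = -(n * Real.pi) by push_cast; ring,
          ih.2] at this
        push_cast at this ⊢
        linarith
  intro y
  obtain ⟨n, hn⟩ := exists_nat_ge |y|
  obtain ⟨h1, h2⟩ := abs_le.1 hn
  have hn0 : (0 : ℝ) ≤ n := n.cast_nonneg
  exact mem_range_of_exists_le_of_exists_ge (continuous_turn hq)
    ⟨_, (h n).2.le.trans (by linarith)⟩ ⟨_, le_trans (by linarith) (h n).1.ge⟩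

/-- The homeomorphism from the polar angle to the uniform angle. -/
noncomputable def turnIso {q : ℝ} (hq : 0 < q) : ℝ ≃o ℝ :=
  (strictMono_turn hq).orderIsoOfSurjective _ (surjective_turn hq)

open Classical in
/-- The polar angle as a function of the uniform angle. -/
noncomputable def polarAngle (q : ℝ) : ℝ → ℝ :=
  if hq : 0 < q then (turnIso hq).symm else id

theorem polarAngle_eq {q : ℝ} (hq : 0 < q) : polarAngle q = (turnIso hq).symm := dif_pos hq

theorem turn_polarAngle {q : ℝ} (hq : 0 < q) (θ : ℝ) : turn q (polarAngle q θ) = θ := by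
  rw [polarAngle_eq hq]; exact (turnIso hq).apply_symm_apply θ

theorem polarAngle_turn {q : ℝ} (hq : 0 < q) (φ : ℝ) : polarAngle q (turn q φ) = φ := by
  rw [polarAngle_eq hq]; exact (turnIso hq).symm_apply_apply φ

theorem continuous_polarAngle {q : ℝ} (hq : 0 < q) : Continuous (polarAngle q) := by
  rw [polarAngle_eq hq]; exact (turnIso hq).symm.continuous

theorem strictMono_polarAngle {q : ℝ} (hq : 0 < q) : StrictMono (polarAngle q) := by
  rw [polarAngle_eq hq]; exact (turnIso hq).symm.strictMono

theorem polarAngle_add_two {q : ℝ} (hq : 0 < q) (θ : ℝ) :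
    polarAngle q (θ + 2) = polarAngle q θ + Real.pi := by
  rw [← polarAngle_turn hq (polarAngle q θ + Real.pi), turn_add_pi hq, turn_polarAngle hq]

theorem polarAngle_natCast {q : ℝ} (hq : 0 < q) (n : ℕ) :
    polarAngle q n = n * (Real.pi / 2) := by
  induction n using Nat.twoStepInduction with
  | zero => simpa [turn_zero] using polarAngle_turn hq 0
  | one => simpa [turn_pi_div_two hq] using polarAngle_turn hq (Real.pi / 2)
  | more n ih _ =>
    push_cast
    rw [polarAngle_add_two hq, ih]; ring

theorem turn_natCast_mul {q : ℝ} (hq : 0 < q) (n : ℕ) : turn q (n * (Real.pi / 2)) = n := by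
  rw [← polarAngle_natCast hq, turn_polarAngle hq]

theorem hasDerivAt_polarAngle {q θ : ℝ} (hq : 0 < q) (hθ : Real.sin (polarAngle q θ) ≠ 0) :
    HasDerivAt (polarAngle q) (quarterTurn q / turnDensity q (polarAngle q θ)) θ := by
  have h := (hasDerivAt_turn hq hθ).of_local_left_inverse (continuous_polarAngle hq).continuousAt
    (div_pos (Real.rpow_pos_of_pos (abs_pos.2 hθ) _) (quarterTurn_pos hq)).ne'
    (Eventually.of_forall (turn_polarAngle hq))
  rwa [inv_div] at h

/-! ### Generalised trigonometric functions -/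

/-- The generalised sine, of period `4`. -/
noncomputable def gsin (q θ : ℝ) : ℝ :=
  |Real.sin (polarAngle q θ)| ^ (2 / q - 1) * Real.sin (polarAngle q θ)

/-- The generalised cosine, of period `4`. -/
noncomputable def gcos (q θ : ℝ) : ℝ := Real.cos (polarAngle q θ)

theorem continuous_gsin {q : ℝ} (hq : 0 < q) : Continuous (gsin q) :=
  (continuous_abs_rpow_sub_one_mul (a := 2 / q) (by positivity)).comp
    (Real.continuous_sin.comp (continuous_polarAngle hq))

theorem continuous_gcos {q : ℝ} (hq : 0 < q) : Continuous (gcos q) :=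
  Real.continuous_cos.comp (continuous_polarAngle hq)

theorem abs_gsin_rpow {q : ℝ} (hq : 0 < q) (θ : ℝ) :
    |gsin q θ| ^ q = Real.sin (polarAngle q θ) ^ 2 := by
  unfold gsin
  rw [abs_abs_rpow_sub_one_mul (by positivity), ← Real.rpow_mul (abs_nonneg _),
    div_mul_cancel₀ _ hq.ne', Real.rpow_two, sq_abs]

theorem gcos_sq_add_abs_gsin_rpow {q : ℝ} (hq : 0 < q) (θ : ℝ) :
    gcos q θ ^ 2 + |gsin q θ| ^ q = 1 := by
  rw [abs_gsin_rpow hq]; exact Real.cos_sq_add_sin_sq _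

theorem gsin_eq_zero_iff_sin {q θ : ℝ} : gsin q θ = 0 ↔ Real.sin (polarAngle q θ) = 0 := by
  refine ⟨fun h => ?_, fun h => by simp [gsin, h]⟩
  by_contra hne
  exact mul_ne_zero (Real.rpow_pos_of_pos (abs_pos.2 hne) _).ne' hne h

/-- A continuous function whose derivative away from a point extends continuously is
differentiable at the point. -/
theorem hasDerivAt_of_eventually_hasDerivAt {f g : ℝ → ℝ} {x : ℝ}
    (h : ∀ᶠ y in 𝓝[≠] x, HasDerivAt f (g y) y) (hf : ContinuousAt f x) (hg : ContinuousAt g x) :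
    HasDerivAt f (g x) x := by
  rw [eventually_nhdsWithin_iff, Metric.eventually_nhds_iff_ball] at h
  obtain ⟨ε, hε, h⟩ := h
  rw [Real.ball_eq_Ioo] at h
  have A : HasDerivWithinAt f (g x) (Ici x) x := by
    have hd : ∀ y ∈ Ioo x (x + ε), HasDerivAt f (g y) y := fun y hy =>
      h y ⟨by linarith [hy.1], hy.2⟩ hy.1.ne'
    have hmem : Ioo x (x + ε) ∈ 𝓝[>] x := Ioo_mem_nhdsGT (by linarith)
    refine hasDerivWithinAt_Ici_of_tendsto_deriv (s := Ioo x (x + ε))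
      (fun y hy => (hd y hy).differentiableAt.differentiableWithinAt)
      hf.continuousWithinAt hmem ?_
    have hg' : Tendsto g (𝓝[>] x) (𝓝 (g x)) := tendsto_inf_left hg
    refine hg'.congr' ?_
    filter_upwards [hmem] with y hy using (hd y hy).deriv.symm
  have B : HasDerivWithinAt f (g x) (Iic x) x := by
    have hd : ∀ y ∈ Ioo (x - ε) x, HasDerivAt f (g y) y := fun y hy =>
      h y ⟨hy.1, by linarith [hy.2]⟩ hy.2.ne
    have hmem : Ioo (x - ε) x ∈ 𝓝[<] x := Ioo_mem_nhdsLT (by linarith)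
    refine hasDerivWithinAt_Iic_of_tendsto_deriv (s := Ioo (x - ε) x)
      (fun y hy => (hd y hy).differentiableAt.differentiableWithinAt)
      hf.continuousWithinAt hmem ?_
    have hg' : Tendsto g (𝓝[<] x) (𝓝 (g x)) := tendsto_inf_left hg
    refine hg'.congr' ?_
    filter_upwards [hmem] with y hy using (hd y hy).deriv.symm
  simpa using B.union A

theorem eventually_sin_polarAngle_ne_zero {q : ℝ} (hq : 0 < q) (θ : ℝ) :
    ∀ᶠ y in 𝓝[≠] θ, Real.sin (polarAngle q y) ≠ 0 := by
  by_cases h : Real.sin (polarAngle q θ) = 0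
  · have h1 : ∀ᶠ φ in 𝓝[≠] (polarAngle q θ), Real.sin φ ≠ 0 := by
      have hd := Real.hasDerivAt_sin (polarAngle q θ)
      have hc : Real.cos (polarAngle q θ) ≠ 0 := by
        intro hc
        have := Real.sin_sq_add_cos_sq (polarAngle q θ)
        rw [h, hc] at this
        norm_num at this
      simpa [h] using hd.eventually_ne (c := 0) hc
    have h2 : Tendsto (polarAngle q) (𝓝[≠] θ) (𝓝[≠] (polarAngle q θ)) :=
      (continuous_polarAngle hq).continuousAt.continuousWithinAt.tendsto_nhdsWithin
        fun y hy => (strictMono_polarAngle hq).injective.ne hy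
    exact h2.eventually h1
  · exact ((Real.continuous_sin.comp (continuous_polarAngle hq)).continuousAt.eventually_ne
      h).filter_mono nhdsWithin_le_nhds

/-- Where the sine vanishes the polar angle need not be differentiable. Elsewhere the factor
`turnDensity` cancels in the chain rule, and the resulting formula is continuous, so it extends to
the exceptional points. -/
theorem hasDerivAt_gsin {q : ℝ} (hq : 0 < q) (θ : ℝ) :
    HasDerivAt (gsin q) (2 / q * quarterTurn q * gcos q θ) θ := by
  refine hasDerivAt_of_eventually_hasDerivAt (g := fun θ => 2 / q * quarterTurn q * gcos q θ) ?_
    (continuous_gsin hq).continuousAt ((continuous_gcos hq).const_mul _).continuousAt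
  filter_upwards [eventually_sin_polarAngle_ne_zero hq θ] with y hy
  have h := (hasDerivAt_abs_rpow_sub_one_mul (a := 2 / q) hy).comp y
    ((hasDerivAt_polarAngle hq hy).sin)
  refine h.congr_deriv ?_
  have : 0 < |Real.sin (polarAngle q y)| ^ (2 / q - 1) := Real.rpow_pos_of_pos (abs_pos.2 hy) _
  unfold turnDensity gcos
  field_simp

/-- The exponents match because `2 * p / q - 1 = -(2 / q - 1)` exactly when `q = p + 1`: dividing
the sine by the density gives the odd `p`-th power of `gsin`. -/
theorem hasDerivAt_gcos {p : ℝ} (hp : 0 < p) (θ : ℝ) :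
    HasDerivAt (gcos (p + 1))
      (-(quarterTurn (p + 1) * (|gsin (p + 1) θ| ^ (p - 1) * gsin (p + 1) θ))) θ := by
  have hq : 0 < p + 1 := by linarith
  refine hasDerivAt_of_eventually_hasDerivAt
    (g := fun θ => -(quarterTurn (p + 1) * (|gsin (p + 1) θ| ^ (p - 1) * gsin (p + 1) θ))) ?_
    (continuous_gcos hq).continuousAt (((continuous_abs_rpow_sub_one_mul hp).comp
      (continuous_gsin hq)).const_mul _).neg.continuousAt
  filter_upwards [eventually_sin_polarAngle_ne_zero hq θ] with y hy
  have h := (hasDerivAt_polarAngle hq hy).cos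
  refine h.congr_deriv ?_
  unfold gsin turnDensity
  rw [abs_rpow_sub_one_mul_comp, show 2 / (p + 1) * p - 1 = -(2 / (p + 1) - 1) by field_simp; ring,
    Real.rpow_neg (abs_nonneg _)]
  ring

/-! ### Quadrants as angular sectors -/

/-- The quadrants in clockwise order, starting from the first one. -/
def clockwiseQuadrant : ℕ → Quadrant
  | 0 => .I
  | 1 => .IV
  | 2 => .III
  | 3 => .II
  | n + 4 => clockwiseQuadrant n

/-- The position of a quadrant in the clockwise order. -/
def Quadrant.index : Quadrant → ℕ
  | .I => 0
  | .IV => 1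
  | .III => 2
  | .II => 3

theorem clockwiseQuadrant_index (q : Quadrant) : clockwiseQuadrant q.index = q := by
  cases q <;> rfl

theorem clockwiseQuadrant_add_four_mul (k n : ℕ) :
    clockwiseQuadrant (k + 4 * n) = clockwiseQuadrant k := by
  induction n with
  | zero => rfl
  | succ n ih => rw [← ih]; rfl

/-- A half turn is a change of sign; this lets statements about all sectors be proved by induction
in steps of two. -/
theorem mem_clockwiseQuadrant_add_two (k : ℕ) (z : ℝ × ℝ) :
    z ∈ (clockwiseQuadrant (k + 2)).carrier ↔ -z ∈ (clockwiseQuadrant k).carrier := by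
  induction k using clockwiseQuadrant.induct with
  | case5 n ih => exact ih
  | _ => simp [clockwiseQuadrant, Quadrant.carrier]

theorem gsin_add_two {q : ℝ} (hq : 0 < q) (θ : ℝ) : gsin q (θ + 2) = -gsin q θ := by
  simp [gsin, polarAngle_add_two hq, Real.sin_add_pi]

theorem gcos_add_two {q : ℝ} (hq : 0 < q) (θ : ℝ) : gcos q (θ + 2) = -gcos q θ := by
  simp [gcos, polarAngle_add_two hq, Real.cos_add_pi]

theorem mul_gsin_mul_gcos_mem {q x y θ : ℝ} (hq : 0 < q) (hx : 0 < x) (hy : 0 < y) {k : ℕ}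
    (hθ : θ ∈ Icc (k : ℝ) (k + 1)) :
    (x * gsin q θ, y * gcos q θ) ∈ (clockwiseQuadrant k).carrier := by
  induction k using Nat.twoStepInduction generalizing θ with
  | zero =>
    have h0 := (strictMono_polarAngle hq).monotone hθ.1
    have h1 := (strictMono_polarAngle hq).monotone (b := ((1 : ℕ) : ℝ)) (by simpa using hθ.2)
    rw [polarAngle_natCast hq] at h0 h1
    simp only [CharP.cast_eq_zero, zero_mul, Nat.cast_one, one_mul] at h0 h1
    have hs := Real.sin_nonneg_of_nonneg_of_le_pi h0 (by linarith [Real.pi_pos])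
    have hc := Real.cos_nonneg_of_neg_pi_div_two_le_of_le (by linarith [Real.pi_pos]) h1
    refine ⟨?_, ?_⟩ <;> simp only [gsin, gcos] <;> positivity
  | one =>
    have h0 := (strictMono_polarAngle hq).monotone hθ.1
    have h1 := (strictMono_polarAngle hq).monotone (a := θ) (b := ((2 : ℕ) : ℝ))
      (by push_cast; push_cast at hθ; linarith [hθ.2])
    rw [polarAngle_natCast hq] at h0 h1
    push_cast at h0 h1
    have hs := Real.sin_nonneg_of_nonneg_of_le_pi (by linarith [Real.pi_pos])
      (show polarAngle q θ ≤ Real.pi by linarith)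
    have hc := Real.cos_nonpos_of_pi_div_two_le_of_le (x := polarAngle q θ) (by linarith) (by linarith [Real.pi_pos])
    refine ⟨?_, mul_nonpos_of_nonneg_of_nonpos hy.le hc⟩
    simp only [gsin]
    positivity
  | more k ih _ =>
    rw [mem_clockwiseQuadrant_add_two]
    have := ih (θ := θ - 2) (by push_cast at hθ; constructor <;> linarith [hθ.1, hθ.2])
    have h1 := gsin_add_two hq (θ - 2)
    have h2 := gcos_add_two hq (θ - 2)
    rw [sub_add_cancel] at h1 h2
    rw [h1, h2]
    simpa using this

theorem gsin_eq_zero_iff {q θ : ℝ} (hq : 0 < q) (hθ : 0 ≤ θ) :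
    gsin q θ = 0 ↔ ∃ n : ℕ, θ = 2 * n := by
  rw [gsin_eq_zero_iff_sin]
  constructor
  · intro h
    obtain ⟨n, hn⟩ := Real.sin_eq_zero_iff.1 h
    have h0 := (strictMono_polarAngle hq).monotone hθ
    have h00 := polarAngle_natCast hq 0
    simp only [CharP.cast_eq_zero, zero_mul] at h00
    rw [h00, ← hn] at h0
    have hn0 : (0 : ℝ) ≤ n := nonneg_of_mul_nonneg_left h0 Real.pi_pos
    obtain ⟨m, rfl⟩ := Int.eq_ofNat_of_zero_le (by exact_mod_cast hn0)
    refine ⟨m, (strictMono_polarAngle hq).injective ?_⟩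
    have := polarAngle_natCast hq (2 * m)
    push_cast at this
    rw [this, ← hn]
    push_cast
    ring
  · rintro ⟨n, rfl⟩
    have := polarAngle_natCast hq (2 * n)
    push_cast at this
    rw [this, show (2 : ℝ) * n * (Real.pi / 2) = n * Real.pi by ring]
    exact Real.sin_nat_mul_pi n

/-- After `k` quarter turns the remaining angle lies in `[0, π / 2]`, and its sine is the distance
to the axis where the quadrant begins: `|X|` for even `k`, `|Y|` for odd `k`. -/
theorem sin_cos_of_mem_clockwiseQuadrant {X Y : ℝ} (h : X ^ 2 + Y ^ 2 = 1) {k : ℕ}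
    (hk : (X, Y) ∈ (clockwiseQuadrant k).carrier) :
    Real.sin (k * (Real.pi / 2) + Real.arcsin (if Even k then |X| else |Y|)) = X ∧
      Real.cos (k * (Real.pi / 2) + Real.arcsin (if Even k then |X| else |Y|)) = Y := by
  have hX : X ^ 2 ≤ 1 := by nlinarith [sq_nonneg Y]
  have hY : Y ^ 2 ≤ 1 := by nlinarith [sq_nonneg X]
  have hX1 : |X| ≤ 1 := (sq_le_one_iff_abs_le_one X).1 hX
  have hY1 : |Y| ≤ 1 := (sq_le_one_iff_abs_le_one Y).1 hY
  induction k using Nat.twoStepInduction generalizing X Y with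
  | zero =>
    obtain ⟨h0, h1⟩ := hk
    simp only at h0 h1
    rw [abs_of_nonneg h0] at hX1
    simp only [CharP.cast_eq_zero, zero_mul, zero_add, Even.zero, if_true, abs_of_nonneg h0]
    refine ⟨Real.sin_arcsin (by linarith) hX1, ?_⟩
    rw [Real.cos_arcsin, show 1 - X ^ 2 = Y ^ 2 by linarith, Real.sqrt_sq h1]
  | one =>
    obtain ⟨h0, h1⟩ := hk
    simp only at h0 h1
    rw [abs_of_nonpos h1] at hY1
    simp only [Nat.cast_one, one_mul, Nat.not_even_one, if_false, abs_of_nonpos h1]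
    rw [add_comm (Real.pi / 2), Real.sin_add_pi_div_two, Real.cos_add_pi_div_two,
      Real.sin_arcsin (by linarith) hY1, Real.cos_arcsin, neg_sq,
      show 1 - Y ^ 2 = X ^ 2 by linarith, Real.sqrt_sq h0, neg_neg]
    exact ⟨rfl, rfl⟩
  | more k ih _ =>
    rw [mem_clockwiseQuadrant_add_two] at hk
    have := ih (X := -X) (Y := -Y) (by simpa using h) hk (by simpa using hX) (by simpa using hY)
      (by simpa using hX1) (by simpa using hY1)
    simp only [abs_neg] at this
    rw [show ((k + 2 : ℕ) : ℝ) * (Real.pi / 2) + Real.arcsin (if Even (k + 2) then |X| else |Y|) =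
      k * (Real.pi / 2) + Real.arcsin (if Even k then |X| else |Y|) + Real.pi by
        simp only [Nat.even_add, even_two, iff_true]; push_cast; ring,
      Real.sin_add_pi, Real.cos_add_pi, this.1, this.2, neg_neg, neg_neg]
    exact ⟨rfl, rfl⟩

/-! ### Energy–angle coordinates -/

/-- The point of energy `c` and uniform angle `θ` (clockwise from the positive `y`-axis). -/
noncomputable def polar (p μ c θ : ℝ) : ℝ × ℝ :=
  (xPlus p μ c * gsin (p + 1) θ, √(2 * c) * gcos (p + 1) θ)

theorem continuous_energy {p : ℝ} (hp : 0 < p) (μ : ℝ) : Continuous (energy p μ) := by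
  unfold energy
  have : Continuous fun z : ℝ × ℝ => |z.1| ^ (p + 1) :=
    continuous_fst.abs.rpow_const fun _ => Or.inr (by linarith)
  fun_prop

theorem xPlus_pos {p μ c : ℝ} (hp : 0 < p) (hμ : 0 < μ) (hc : 0 < c) : 0 < xPlus p μ c := by
  unfold xPlus; positivity

theorem xPlus_rpow {p μ c : ℝ} (hp : 0 < p) (hμ : 0 < μ) (hc : 0 ≤ c) :
    xPlus p μ c ^ (p + 1) = (p + 1) * c / μ := by
  have hq : p + 1 ≠ 0 := by linarith
  rw [xPlus, ← Real.rpow_mul (by positivity), one_div_mul_cancel hq, Real.rpow_one]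

theorem continuous_xPlus {p : ℝ} (hp : 0 < p) (μ : ℝ) : Continuous (xPlus p μ) := by
  unfold xPlus
  exact Continuous.rpow_const (by fun_prop) fun _ => Or.inr (by positivity)

theorem energy_polar {p μ c : ℝ} (hp : 0 < p) (hμ : 0 < μ) (hc : 0 < c) (θ : ℝ) :
    energy p μ (polar p μ c θ) = c := by
  have hx := xPlus_pos hp hμ hc
  simp only [energy, polar]
  rw [abs_mul, abs_of_pos hx, Real.mul_rpow hx.le (abs_nonneg _), xPlus_rpow hp hμ hc.le, mul_pow,
    Real.sq_sqrt (by linarith)]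
  have h := gcos_sq_add_abs_gsin_rpow (q := p + 1) (by linarith) θ
  have h3 : |gsin (p + 1) θ| ^ (p + 1) = 1 - gcos (p + 1) θ ^ 2 := by linarith
  rw [h3]
  field_simp
  ring

theorem polar_mem {p μ c : ℝ} (hp : 0 < p) (hμ : 0 < μ) (hc : 0 < c) {k : ℕ} {θ : ℝ}
    (hθ : θ ∈ Icc (k : ℝ) (k + 1)) : polar p μ c θ ∈ (clockwiseQuadrant k).carrier :=
  mul_gsin_mul_gcos_mem (by linarith) (xPlus_pos hp hμ hc) (by positivity) hθ

theorem continuous_polar {p : ℝ} (hp : 0 < p) (μ : ℝ) :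
    Continuous fun w : ℝ × ℝ => polar p μ w.1 w.2 := by
  have h1 := continuous_xPlus hp μ
  have h2 := continuous_gsin (q := p + 1) (by linarith)
  have h3 := continuous_gcos (q := p + 1) (by linarith)
  unfold polar
  fun_prop

/-- The uniform angle, in `[k, k + 1]`, of a point of the `k`-th quadrant in clockwise order. -/
noncomputable def sectorAngle (p μ : ℝ) (k : ℕ) (z : ℝ × ℝ) : ℝ :=
  turn (p + 1) (k * (Real.pi / 2) + Real.arcsin (if Even k then
    |z.1 / xPlus p μ (energy p μ z)| ^ ((p + 1) / 2) else |z.2 / √(2 * energy p μ z)|))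

/-- No quadrant condition on `z` is needed, since `Real.arcsin` maps every nonnegative number into
`[0, π / 2]`. -/
theorem sectorAngle_mem {p μ : ℝ} (hp : 0 < p) (k : ℕ) (z : ℝ × ℝ) :
    sectorAngle p μ k z ∈ Icc (k : ℝ) (k + 1) := by
  have hq : 0 < p + 1 := by linarith
  have h0 := turn_natCast_mul hq k
  have h1 := turn_natCast_mul hq (k + 1)
  push_cast at h1
  unfold sectorAngle
  set w := if Even k then
    |z.1 / xPlus p μ (energy p μ z)| ^ ((p + 1) / 2) else |z.2 / √(2 * energy p μ z)|
  have hw : 0 ≤ w := by simp only [w]; split_ifs <;> positivity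
  constructor
  · refine h0.ge.trans ((strictMono_turn hq).monotone ?_)
    linarith [Real.arcsin_nonneg.2 hw]
  · refine le_trans ?_ h1.le
    exact (strictMono_turn hq).monotone (by linarith [Real.arcsin_le_pi_div_two w])

theorem polar_sectorAngle {p μ : ℝ} (hp : 0 < p) (hμ : 0 < μ) {k : ℕ} {z : ℝ × ℝ}
    (hz : 0 < energy p μ z) (hk : z ∈ (clockwiseQuadrant k).carrier) :
    polar p μ (energy p μ z) (sectorAngle p μ k z) = z := by
  have hq : 0 < p + 1 := by linarith
  set c := energy p μ z with hc
  have hx := xPlus_pos hp hμ hz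
  have hy : 0 < √(2 * c) := by positivity
  set ξ := z.1 / xPlus p μ c with hξ
  set Y := z.2 / √(2 * c) with hY
  set X := |ξ| ^ ((p + 1) / 2 - 1) * ξ with hX
  have hXabs : |X| = |ξ| ^ ((p + 1) / 2) := abs_abs_rpow_sub_one_mul (by linarith)
  have hz1 : z.1 = xPlus p μ c * ξ := by rw [hξ]; field_simp
  have hz2 : z.2 = √(2 * c) * Y := by rw [hY]; field_simp
  have hXY : X ^ 2 + Y ^ 2 = 1 := by
    have h2 : X ^ 2 = |ξ| ^ (p + 1) := by
      rw [← sq_abs, hXabs, ← Real.rpow_natCast, ← Real.rpow_mul (abs_nonneg _)]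
      norm_num
    have h3 : c = z.2 ^ 2 / 2 + μ / (p + 1) * |z.1| ^ (p + 1) := hc
    rw [hz1, hz2, abs_mul, abs_of_pos hx, Real.mul_rpow hx.le (abs_nonneg _),
      xPlus_rpow hp hμ hz.le, mul_pow, Real.sq_sqrt (by linarith), ← h2] at h3
    field_simp at h3
    nlinarith
  have hmem : (X, Y) ∈ (clockwiseQuadrant k).carrier := by
    have hX' : ∀ s : ℝ, (0 ≤ s * z.1 → 0 ≤ s * X) := by
      intro s h
      rw [hz1] at h
      have : 0 ≤ s * ξ := by
        rw [mul_left_comm] at h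
        exact nonneg_of_mul_nonneg_right h hx
      rw [hX, mul_left_comm]
      positivity
    have hY' : ∀ s : ℝ, (0 ≤ s * z.2 → 0 ≤ s * Y) := by
      intro s h
      rw [hY, ← mul_div_assoc]
      positivity
    have a1 := hX' 1
    have a2 := hX' (-1)
    have b1 := hY' 1
    have b2 := hY' (-1)
    simp only [one_mul, neg_mul, Left.nonneg_neg_iff] at a1 a2 b1 b2
    generalize clockwiseQuadrant k = Q at hk
    cases Q <;> obtain ⟨h1, h2⟩ := hk <;> constructor <;> simp only <;> tauto
  obtain ⟨hs, hco⟩ := sin_cos_of_mem_clockwiseQuadrant hXY hmem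
  rw [hXabs] at hs hco
  have hang : polarAngle (p + 1) (sectorAngle p μ k z) = k * (Real.pi / 2) +
      Real.arcsin (if Even k then |ξ| ^ ((p + 1) / 2) else |Y|) := polarAngle_turn hq _
  have hS : gsin (p + 1) (sectorAngle p μ k z) = ξ := by
    unfold gsin
    rw [hang, hs, hX, abs_rpow_sub_one_mul_comp,
      show (p + 1) / 2 * (2 / (p + 1)) - 1 = 0 by field_simp; ring, Real.rpow_zero, one_mul]
  have hC : gcos (p + 1) (sectorAngle p μ k z) = Y := by
    unfold gcos
    rw [hang, hco]
  unfold polar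
  rw [hS, hC, ← hz1, ← hz2]

theorem continuousOn_sectorAngle {p μ : ℝ} (hp : 0 < p) (hμ : 0 < μ) (k : ℕ) :
    ContinuousOn (sectorAngle p μ k) {z | 0 < energy p μ z} := by
  have hE := continuous_energy hp μ
  have hX := continuous_xPlus hp μ
  unfold sectorAngle
  refine (continuous_turn (by linarith)).comp_continuousOn (continuousOn_const.add
    (Real.continuous_arcsin.comp_continuousOn ?_))
  split_ifs
  · refine ContinuousOn.rpow_const (ContinuousOn.abs (ContinuousOn.div (by fun_prop) (by fun_prop)
      fun z hz => (xPlus_pos hp hμ hz).ne')) fun _ _ => Or.inr (by linarith)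
  · refine ContinuousOn.abs (ContinuousOn.div (by fun_prop) (by fun_prop) fun z hz => ?_)
    have : 0 < energy p μ z := hz
    positivity

/-! ### The flow in energy–angle coordinates -/

/-- The uniform angular speed on the orbit of energy `c`. -/
noncomputable def angularSpeed (p μ c : ℝ) : ℝ := 4 / period p μ (xPlus p μ c)

theorem period_xPlus {p μ c : ℝ} (hp : 0 < p) (hμ : 0 < μ) (hc : 0 < c) :
    period p μ (xPlus p μ c) =
      4 * (xPlus p μ c / √(2 * c) * (2 / (p + 1) * quarterTurn (p + 1))) := by
  have hq : 0 < p + 1 := by linarith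
  have hx := xPlus_pos hp hμ hc
  have hK : 2 * μ / (p + 1) * xPlus p μ c ^ (p - 1) = 2 * c / xPlus p μ c ^ 2 := by
    rw [show p - 1 = (p + 1) - 2 by ring, Real.rpow_sub hx, xPlus_rpow hp hμ hc.le, Real.rpow_two]
    field_simp
  unfold period
  rw [hK]
  simp_rw [Real.sqrt_mul (show 0 ≤ 2 * c / xPlus p μ c ^ 2 by positivity), ← one_div_mul_one_div]
  rw [intervalIntegral.integral_const_mul, quarterTurn_eq hq, Real.sqrt_div (by positivity),
    Real.sqrt_sq hx.le]
  field_simp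

theorem period_xPlus_pos {p μ c : ℝ} (hp : 0 < p) (hμ : 0 < μ) (hc : 0 < c) :
    0 < period p μ (xPlus p μ c) := by
  rw [period_xPlus hp hμ hc]
  have := xPlus_pos hp hμ hc
  have := quarterTurn_pos (q := p + 1) (by linarith)
  positivity

theorem angularSpeed_pos {p μ c : ℝ} (hp : 0 < p) (hμ : 0 < μ) (hc : 0 < c) :
    0 < angularSpeed p μ c := div_pos (by norm_num) (period_xPlus_pos hp hμ hc)

theorem angularSpeed_eq {p μ c : ℝ} (hp : 0 < p) (hμ : 0 < μ) (hc : 0 < c) :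
    angularSpeed p μ c =
      √(2 * c) * (p + 1) / (2 * xPlus p μ c * quarterTurn (p + 1)) := by
  have := xPlus_pos hp hμ hc
  have := quarterTurn_pos (q := p + 1) (by linarith)
  rw [angularSpeed, period_xPlus hp hμ hc]
  field_simp

theorem continuousOn_angularSpeed {p μ : ℝ} (hp : 0 < p) (hμ : 0 < μ) :
    ContinuousOn (angularSpeed p μ) (Ioi 0) := by
  have hX := continuous_xPlus hp μ
  have hT := quarterTurn_pos (q := p + 1) (by linarith)
  have : ContinuousOn (fun c => √(2 * c) * (p + 1) / (2 * xPlus p μ c * quarterTurn (p + 1)))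
      (Ioi 0) := by
    refine ContinuousOn.div (by fun_prop) (by fun_prop) fun c hc => ?_
    have := xPlus_pos hp hμ hc
    positivity
  exact this.congr fun c hc => angularSpeed_eq hp hμ hc

/-- With the next lemma: uniform rotation at speed `angularSpeed` solves `x' = y`, `y' = -μ
|x|^(p-1) x`. -/
theorem hasDerivAt_polar_fst {p μ c : ℝ} (hp : 0 < p) (hμ : 0 < μ) (hc : 0 < c) (θ T x : ℝ) :
    HasDerivAt (fun x => (polar p μ c (θ + angularSpeed p μ c * (x - T))).1)
      (polar p μ c (θ + angularSpeed p μ c * (x - T))).2 x := by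
  have hq : 0 < p + 1 := by linarith
  have hx := xPlus_pos hp hμ hc
  have hT := quarterTurn_pos (q := p + 1) (by linarith)
  have hin : HasDerivAt (fun x => θ + angularSpeed p μ c * (x - T)) (angularSpeed p μ c) x := by
    simpa using (((hasDerivAt_id x).sub_const T).const_mul (angularSpeed p μ c)).const_add θ
  have h := ((hasDerivAt_gsin hq (θ + angularSpeed p μ c * (x - T))).comp x hin).const_mul
    (xPlus p μ c)
  refine h.congr_deriv ?_
  simp only [polar]
  generalize gcos (p + 1) (θ + angularSpeed p μ c * (x - T)) = C
  rw [angularSpeed_eq hp hμ hc]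
  field_simp

theorem hasDerivAt_polar_snd {p μ c : ℝ} (hp : 0 < p) (hμ : 0 < μ) (hc : 0 < c) (θ T x : ℝ) :
    HasDerivAt (fun x => (polar p μ c (θ + angularSpeed p μ c * (x - T))).2)
      (-(μ * (|(polar p μ c (θ + angularSpeed p μ c * (x - T))).1| ^ (p - 1) *
        (polar p μ c (θ + angularSpeed p μ c * (x - T))).1))) x := by
  have hx := xPlus_pos hp hμ hc
  have hT := quarterTurn_pos (q := p + 1) (by linarith)
  have hin : HasDerivAt (fun x => θ + angularSpeed p μ c * (x - T)) (angularSpeed p μ c) x := by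
    simpa using (((hasDerivAt_id x).sub_const T).const_mul (angularSpeed p μ c)).const_add θ
  have h := ((hasDerivAt_gcos hp (θ + angularSpeed p μ c * (x - T))).comp x hin).const_mul
    (√(2 * c))
  refine h.congr_deriv ?_
  simp only [polar]
  generalize gsin (p + 1) (θ + angularSpeed p μ c * (x - T)) = S
  rw [abs_mul, abs_of_pos hx, Real.mul_rpow hx.le (abs_nonneg _), Real.rpow_sub hx,
    show xPlus p μ c ^ p = xPlus p μ c ^ (p + 1) / xPlus p μ c by
      rw [Real.rpow_add_one hx.ne', mul_div_cancel_right₀ _ hx.ne'], xPlus_rpow hp hμ hc.le,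
    angularSpeed_eq hp hμ hc, Real.rpow_one]
  have hs : √(2 * c) ^ 2 = 2 * c := Real.sq_sqrt (by linarith)
  field_simp
  rw [hs]

/-! ### Counting zeros -/

/-- The number of quadrants by which one moves clockwise from `q` to reach the first copy of `q'`
after passing over the quadrant next to `q`. -/
def sweep (q q' : Quadrant) : ℕ := 2 + (q'.index + 6 - q.index) % 4

/-- In `sweep`, adding `6` means subtracting `2` modulo `4`, while keeping the natural subtraction
from being truncated. -/
theorem clockwiseQuadrant_sweep (q q' : Quadrant) :
    clockwiseQuadrant (q.index + sweep q q') = q' := by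
  cases q <;> cases q' <;> rfl

theorem two_le_sweep (q q' : Quadrant) : 2 ≤ sweep q q' := Nat.le_add_right _ _

theorem sweep_le_five (q q' : Quadrant) : sweep q q' ≤ 5 := by
  unfold sweep; omega

/-- The right side counts the even integers in `(k, k + sweep q q']` with `k = q.index`, that is,
the crossings of the `y`-axis. -/
theorem offset_eq (q q' : Quadrant) :
    offset q q' = (q.index + sweep q q') / 2 - q.index / 2 := by
  cases q <;> cases q' <;> rfl

theorem index_odd_iff (q : Quadrant) : (q = .II ∨ q = .IV) ↔ q.index % 2 = 1 := by
  cases q <;> simp [Quadrant.index]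

theorem index_add_sweep_even_iff (q q' : Quadrant) :
    (q' = .I ∨ q' = .III) ↔ (q.index + sweep q q') % 2 = 0 := by
  cases q <;> cases q' <;> simp [Quadrant.index, sweep]

theorem encard_zeros_gsin {r X θ ω T S : ℝ} (hr : 0 < r) (hX : 0 < X) (hω : 0 < ω)
    {q q' : Quadrant} {N : ℕ} (hθ : θ ∈ Icc (q.index : ℝ) (q.index + 1))
    (hΘ : θ + ω * (S - T) ∈ Icc ((q.index + 4 * N + sweep q q' : ℕ) : ℝ)
      ((q.index + 4 * N + sweep q q' : ℕ) + 1))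
    {u : ℝ → ℝ} (hu : ∀ x ∈ Icc T S, u x = X * gsin r (θ + ω * (x - T))) :
    {x ∈ countingInterval q q' T S | u x = 0}.encard = ((2 * N + offset q q' : ℕ) : ℕ∞) := by
  have hodd := index_odd_iff q
  have heven := index_add_sweep_even_iff q q'
  have hoff := offset_eq q q'
  have hsw := two_le_sweep q q'
  set k := q.index
  set K := k + 4 * N + sweep q q' with hK
  have hk0 : (0 : ℝ) ≤ k := k.cast_nonneg
  -- The zero with index `j` occurs when the angle equals `2 * j`. The angle runs from `[k, k + 1]`
  -- to `[K, K + 1]`, and the end conventions of `countingInterval` select exactly `k < 2 * j ≤ K`.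
  have hset : {x ∈ countingInterval q q' T S | u x = 0} =
      (fun j : ℕ => T + (2 * j - θ) / ω) '' (Finset.Ioc (k / 2) (K / 2) : Set ℕ) := by
    ext x
    simp only [countingInterval, mem_ofPred_eq, mem_image, Finset.coe_Ioc, mem_Ioc]
    constructor
    · rintro ⟨⟨h1, h2, h3, h4⟩, h5⟩
      have hy0 : 0 ≤ ω * (x - T) := mul_nonneg hω.le (by linarith)
      have hy1 : ω * (x - T) ≤ ω * (S - T) := by gcongr
      rw [hu x ⟨h1, h2⟩] at h5
      have h6 := (mul_eq_zero.1 h5).resolve_left hX.ne'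
      rw [gsin_eq_zero_iff hr (by linarith [hθ.1])] at h6
      obtain ⟨n, hn⟩ := h6
      refine ⟨n, ⟨?_, ?_⟩, ?_⟩
      · have h7 : k ≤ 2 * n := by exact_mod_cast (show (k : ℝ) ≤ 2 * n by linarith [hθ.1])
        -- If `2 * n = k`, the zero is at time `T`, which is counted only for odd `k`: a
        -- contradiction.
        rcases h7.eq_or_lt with h8 | h8
        · have h9 : (k : ℝ) = 2 * n := by exact_mod_cast h8
          have h10 : ω * (x - T) = 0 := by linarith [hθ.1]
          have h11 : x = T := by
            rcases mul_eq_zero.1 h10 with h | h <;> linarith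
          have := hodd.1 (h3 h11)
          omega
        · omega
      · have h7 : 2 * n ≤ K + 1 := by
          exact_mod_cast (show (2 * n : ℝ) ≤ K + 1 by linarith [hΘ.2])
        -- If `2 * n = K + 1`, the zero is at time `S`, which is counted only for even `K`.
        rcases h7.eq_or_lt with h8 | h8
        · have h9 : (2 * n : ℝ) = K + 1 := by exact_mod_cast h8
          have h10 : ω * (S - x) = 0 := by
            have : ω * (S - x) = ω * (S - T) - ω * (x - T) := by ring
            linarith [hΘ.2]
          have h11 : x = S := by
            rcases mul_eq_zero.1 h10 with h | h <;> linarith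
          have := heven.1 (h4 h11)
          omega
        · omega
      · rw [← hn]
        field_simp
        ring
    · rintro ⟨n, ⟨h1, h2⟩, rfl⟩
      have h3 : (k : ℝ) + 1 ≤ 2 * n := by exact_mod_cast (show k + 1 ≤ 2 * n by omega)
      have h4 : (2 * n : ℝ) ≤ K := by exact_mod_cast (show 2 * n ≤ K by omega)
      have h5 : T ≤ T + (2 * n - θ) / ω := by
        have : 0 ≤ (2 * n - θ) / ω := div_nonneg (by linarith [hθ.2]) hω.le
        linarith
      have h6 : T + (2 * n - θ) / ω ≤ S := by
        have : (2 * n - θ) / ω ≤ S - T := by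
          rw [div_le_iff₀ hω]; linarith [hΘ.1]
        linarith
      refine ⟨⟨h5, h6, fun h => ?_, fun h => ?_⟩, ?_⟩
      · have h7 : (2 * n - θ) / ω = 0 := by linarith
        have h8 : 2 * n - θ = 0 := (div_eq_zero_iff.1 h7).resolve_right hω.ne'
        have h9 : 2 * n = k + 1 := by
          exact_mod_cast (show (2 * n : ℝ) = k + 1 by linarith [hθ.2])
        exact hodd.2 (by omega)
      · have h7 : (2 * n - θ) / ω = S - T := by linarith
        rw [div_eq_iff hω.ne'] at h7
        have h9 : 2 * n = K := by
          exact_mod_cast (show (2 * n : ℝ) = K by linarith [hΘ.1])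
        exact heven.2 (by omega)
      · rw [hu _ ⟨h5, h6⟩, show θ + ω * (T + (2 * n - θ) / ω - T) = 2 * n by field_simp; ring,
          (gsin_eq_zero_iff hr (by positivity)).2 ⟨n, rfl⟩, mul_zero]
  have hinj : InjOn (fun j : ℕ => T + (2 * j - θ) / ω) (Finset.Ioc (k / 2) (K / 2) : Set ℕ) := by
    intro i _ j _ hij
    simp only [add_right_inj] at hij
    rw [div_left_inj' hω.ne'] at hij
    exact_mod_cast (show (i : ℝ) = j by linarith)
  rw [hset, hinj.encard_image, encard_coe_eq_coe_finsetCard, Nat.card_Ioc]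
  congr 1
  omega

/-! ### Solutions with finitely many exceptional times -/

/-- A solution of the equation on `[A, B]` in the classical sense away from finitely many times. -/
structure PiecewiseSolution (p : ℝ) (a : ℝ → ℝ) (A B : ℝ) (u v : ℝ → ℝ) : Prop where
  continuous_fst : Continuous u
  continuous_snd : Continuous v
  hasDerivAt : ∃ F : Set ℝ, F.Finite ∧ ∀ x ∈ Ioo A B \ F,
    HasDerivAt u (v x) x ∧ HasDerivAt v (-(a x * (|u x| ^ (p - 1) * u x))) x

theorem PiecewiseSolution.glue {p : ℝ} {a : ℝ → ℝ} {A B C : ℝ} {u v u' v' : ℝ → ℝ}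
    (h : PiecewiseSolution p a A B u v) (h' : PiecewiseSolution p a B C u' v')
    (hu : u B = u' B) (hv : v B = v' B) :
    PiecewiseSolution p a A C (fun x => if x ≤ B then u x else u' x)
      (fun x => if x ≤ B then v x else v' x) := by
  obtain ⟨F, hF, hd⟩ := h.hasDerivAt
  obtain ⟨F', hF', hd'⟩ := h'.hasDerivAt
  refine ⟨h.continuous_fst.if_le h'.continuous_fst continuous_id continuous_const
      (by rintro x rfl; exact hu),
    h.continuous_snd.if_le h'.continuous_snd continuous_id continuous_const
      (by rintro x rfl; exact hv), F ∪ F' ∪ {B}, (hF.union hF').union (finite_singleton B), ?_⟩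
  rintro x ⟨hx, hxF⟩
  simp only [union_singleton, mem_insert_iff, mem_union, not_or] at hxF
  rcases lt_or_gt_of_ne hxF.1 with hlt | hlt
  · obtain ⟨h1, h2⟩ := hd x ⟨⟨hx.1, hlt⟩, hxF.2.1⟩
    simp only [hlt.le, if_true]
    have hev : ∀ᶠ y in 𝓝 x, y ≤ B := by
      filter_upwards [Iio_mem_nhds hlt] with y hy using le_of_lt hy
    exact ⟨h1.congr_of_eventuallyEq (hev.mono fun y hy => if_pos hy),
      h2.congr_of_eventuallyEq (hev.mono fun y hy => if_pos hy)⟩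
  · obtain ⟨h1, h2⟩ := hd' x ⟨⟨hlt, hx.2⟩, hxF.2.2⟩
    simp only [hlt.not_ge, if_false]
    have hev : ∀ᶠ y in 𝓝 x, ¬ y ≤ B := by
      filter_upwards [Ioi_mem_nhds hlt] with y hy using not_le_of_gt hy
    exact ⟨h1.congr_of_eventuallyEq (hev.mono fun y hy => if_neg hy),
      h2.congr_of_eventuallyEq (hev.mono fun y hy => if_neg hy)⟩

/-- The fundamental theorem of calculus tolerates countably many exceptional times: `u` is a
primitive of the continuous `v`, hence differentiable everywhere, and `v` is Lipschitz because its
derivative is bounded off these times. -/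
theorem PiecewiseSolution.isSolution {p : ℝ} (hp : 0 < p) {a : ℝ → ℝ} {L M : ℝ} (hL : 0 ≤ L)
    (ha : Measurable a) (hM : ∀ x, |a x| ≤ M) {u v : ℝ → ℝ}
    (h : PiecewiseSolution p a 0 L u v) : IsSolution p a L u v := by
  obtain ⟨F, hF, hd⟩ := h.hasDerivAt
  have hu := h.continuous_fst
  have hv := h.continuous_snd
  have hf : Continuous fun x => |u x| ^ (p - 1) * u x := (continuous_abs_rpow_sub_one_mul hp).comp hu
  refine ⟨fun x hx => ?_, ?_, ?_⟩
  · have key : ∀ y ∈ Icc 0 L, u y = u 0 + ∫ r in (0 : ℝ)..y, v r := by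
      intro y hy
      have := integral_eq_of_hasDerivAt_off_countable_of_le u v hy.1 hF.countable
        hu.continuousOn (fun z hz => (hd z ⟨⟨hz.1.1, hz.1.2.trans_le hy.2⟩, hz.2⟩).1)
        (hv.intervalIntegrable _ _)
      rw [this]; ring
    have hD : HasDerivAt (fun y => u 0 + ∫ r in (0 : ℝ)..y, v r) (v x) x :=
      (intervalIntegral.integral_hasDerivAt_right (hv.intervalIntegrable _ _)
        (hv.stronglyMeasurableAtFilter _ _) hv.continuousAt).const_add _
    exact hD.hasDerivWithinAt.congr key (key x hx)
  · obtain ⟨C, hC⟩ := (isCompact_Icc (a := (0 : ℝ)) (b := L)).exists_bound_of_continuousOn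
      hf.continuousOn
    have hM0 : 0 ≤ M := (abs_nonneg _).trans (hM 0)
    have hC0 : 0 ≤ C := (norm_nonneg _).trans (hC 0 ⟨le_rfl, hL⟩)
    refine LipschitzOnWith.absolutelyContinuousOnInterval (K := (M * C).toNNReal) ?_
    rw [uIcc_of_le hL]
    have hle : ∀ x ∈ Icc 0 L, ∀ y ∈ Icc 0 L, x ≤ y → |v y - v x| ≤ M * C * |y - x| := by
      intro x hx y hy hxy
      have hint : IntervalIntegrable (fun r => -(a r * (|u r| ^ (p - 1) * u r))) volume x y := by
        rw [intervalIntegrable_iff_integrableOn_Icc_of_le hxy]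
        exact (Integrable.bdd_mul (hf.continuousOn.integrableOn_Icc) ha.aestronglyMeasurable
          (Eventually.of_forall hM)).neg
      have := integral_eq_of_hasDerivAt_off_countable_of_le v
        (fun r => -(a r * (|u r| ^ (p - 1) * u r))) hxy hF.countable
        hv.continuousOn (fun z hz =>
          (hd z ⟨⟨hx.1.trans_lt hz.1.1, hz.1.2.trans_le hy.2⟩, hz.2⟩).2) hint
      rw [← this, ← Real.norm_eq_abs]
      refine intervalIntegral.norm_integral_le_of_norm_le_const fun r hr => ?_
      rw [uIoc_of_le hxy] at hr
      rw [norm_neg, norm_mul]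
      exact mul_le_mul (hM r) (hC r ⟨hx.1.trans hr.1.le, hr.2.trans hy.2⟩) (norm_nonneg _) hM0
    refine LipschitzOnWith.of_dist_le_mul fun x hx y hy => ?_
    rw [Real.coe_toNNReal _ (by positivity), Real.dist_eq, Real.dist_eq]
    rcases le_total x y with hxy | hxy
    · rw [abs_sub_comm, abs_sub_comm x]; exact hle x hx y hy hxy
    · exact hle y hy x hx hxy
  · rw [ae_restrict_iff' measurableSet_Icc]
    have hFn : ∀ᵐ x : ℝ, x ∉ F ∪ {0, L} :=
      measure_eq_zero_iff_ae_notMem.1 ((hF.union (by simp)).measure_zero _)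
    filter_upwards [hFn] with x hx hxL
    simp only [mem_union, mem_insert_iff, mem_singleton_iff, not_or] at hx
    exact (hd x ⟨⟨lt_of_le_of_ne hxL.1 (Ne.symm hx.2.1), lt_of_le_of_ne hxL.2 hx.2.2⟩, hx.1⟩).2

/-! ### The stepwise weight -/

section Weight

variable {m : ℕ} {t s μ : Fin (m + 1) → ℝ}

theorem measurable_stepWeight : Measurable (stepWeight t s μ) :=
  Finset.measurable_fun_sum _ fun _ _ => measurable_const.indicator measurableSet_Icc

theorem abs_stepWeight_le (x : ℝ) : |stepWeight t s μ x| ≤ ∑ i, |μ i| := by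
  refine (Finset.abs_sum_le_sum_abs _ _).trans (Finset.sum_le_sum fun i _ => ?_)
  by_cases h : x ∈ Icc (t i) (s i) <;> simp [h]

theorem strictMono_start (hts : ∀ i, t i < s i) (hst : ∀ i : Fin m, s i.castSucc < t i.succ) :
    StrictMono t :=
  Fin.strictMono_iff_lt_succ.2 fun i => (hts _).trans (hst i)

theorem end_le_start (hts : ∀ i, t i < s i) (hst : ∀ i : Fin m, s i.castSucc < t i.succ)
    {i j : Fin (m + 1)} (hij : i < j) : s i < t j := by
  obtain ⟨k, rfl⟩ := Fin.exists_castSucc_eq.2 (ne_of_lt (hij.trans_le (Fin.le_last j)))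
  exact (hst k).trans_le ((strictMono_start hts hst).monotone (Fin.castSucc_lt_iff_succ_le.1 hij))

theorem stepWeight_of_mem (hts : ∀ i, t i < s i) (hst : ∀ i : Fin m, s i.castSucc < t i.succ)
    (i : Fin (m + 1)) {x : ℝ} (hx : x ∈ Ioo (t i) (s i)) : stepWeight t s μ x = μ i := by
  unfold stepWeight
  rw [Finset.sum_eq_single i]
  · exact indicator_of_mem (Ioo_subset_Icc_self hx) _
  · intro j _ hj
    refine indicator_of_notMem (fun h => ?_) _
    rcases lt_or_gt_of_ne hj with hlt | hlt
    · linarith [end_le_start hts hst hlt, h.2, hx.1]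
    · linarith [end_le_start hts hst hlt, h.1, hx.2]
  · simp

theorem stepWeight_of_mem_gap (hts : ∀ i, t i < s i) (hst : ∀ i : Fin m, s i.castSucc < t i.succ)
    (i : Fin m) {x : ℝ} (hx : x ∈ Ioo (s i.castSucc) (t i.succ)) : stepWeight t s μ x = 0 := by
  refine Finset.sum_eq_zero fun j _ => indicator_of_notMem (fun h => ?_) _
  rcases le_or_gt j i.castSucc with hj | hj
  · have : s j ≤ s i.castSucc := by
      rcases hj.eq_or_lt with rfl | hlt
      · exact le_rfl
      · exact ((end_le_start hts hst hlt).trans (hts _)).le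
    linarith [h.2, hx.1]
  · have := (strictMono_start hts hst).monotone (Fin.castSucc_lt_iff_succ_le.1 hj)
    linarith [h.1, hx.2]

end Weight

/-! ### Energy estimates -/

theorem energy_neg (p μ : ℝ) (z : ℝ × ℝ) : energy p μ (-z) = energy p μ z := by
  simp [energy]

theorem abs_fst_le_xPlus {p μ c : ℝ} (hp : 0 < p) (hμ : 0 < μ) {z : ℝ × ℝ}
    (h : energy p μ z ≤ c) : |z.1| ≤ xPlus p μ c := by
  have hq : 0 < p + 1 := by linarith
  have h1 : μ / (p + 1) * |z.1| ^ (p + 1) ≤ c := by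
    unfold energy at h; nlinarith [sq_nonneg z.2]
  have h2 : |z.1| ^ (p + 1) ≤ (p + 1) * c / μ := by
    rw [le_div_iff₀ hμ]
    rw [div_mul_eq_mul_div, div_le_iff₀ hq] at h1
    linarith
  calc |z.1| = (|z.1| ^ (p + 1)) ^ (1 / (p + 1)) := by
        rw [← Real.rpow_mul (abs_nonneg _), mul_one_div_cancel hq.ne', Real.rpow_one]
    _ ≤ _ := by unfold xPlus; gcongr

theorem abs_snd_le_sqrt {p μ c : ℝ} (hp : 0 < p) (hμ : 0 < μ) {z : ℝ × ℝ}
    (h : energy p μ z ≤ c) : |z.2| ≤ √(2 * c) := by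
  refine Real.abs_le_sqrt ?_
  have : 0 ≤ μ / (p + 1) * |z.1| ^ (p + 1) := by positivity
  unfold energy at h
  linarith

theorem le_energy_of_xPlus_le {p μ c : ℝ} (hp : 0 < p) (hμ : 0 < μ) (hc : 0 < c) {z : ℝ × ℝ}
    (h : xPlus p μ c ≤ |z.1|) : c ≤ energy p μ z := by
  have h1 : xPlus p μ c ^ (p + 1) ≤ |z.1| ^ (p + 1) :=
    Real.rpow_le_rpow (xPlus_pos hp hμ hc).le h (by linarith)
  rw [xPlus_rpow hp hμ hc.le, div_le_iff₀ hμ] at h1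
  have h2 : c ≤ μ / (p + 1) * |z.1| ^ (p + 1) := by
    rw [div_mul_eq_mul_div, le_div_iff₀ (by linarith)]
    linarith
  unfold energy
  nlinarith [sq_nonneg z.2]

theorem energy_zero {p : ℝ} (hp : 0 < p) (μ : ℝ) : energy p μ 0 = 0 := by
  simp [energy, Real.zero_rpow (show p + 1 ≠ 0 by linarith)]

theorem energy_of_fst_eq_zero {p : ℝ} (hp : 0 < p) (μ : ℝ) {z : ℝ × ℝ} (hz : z.1 = 0) :
    energy p μ z = z.2 ^ 2 / 2 := by
  simp [energy, hz, Real.zero_rpow (show p + 1 ≠ 0 by linarith)]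

theorem annulus_energy_pos {p μ d e : ℝ} (hd : 0 < d) (he : 0 < e) {z : ℝ × ℝ}
    (hz : z ∈ annulus p μ d e) : 0 < energy p μ z := (lt_min hd he).trans_le hz.1

/-- An arc from the origin to infinity contains a path between two prescribed energy levels. -/
theorem IsArcToInfinity.exists_path {p μ : ℝ} (hp : 0 < p) (hμ : 0 < μ) {R : Set (ℝ × ℝ)}
    (hR : IsArcToInfinity R) {a b : ℝ} (ha : 0 < a) (hb : 0 < b) :
    ∃ Y : ℝ → ℝ × ℝ, Continuous Y ∧ energy p μ (Y 0) = a ∧ energy p μ (Y 1) = b ∧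
      ∀ σ, Y σ ∈ R ∧ Y σ ∈ annulus p μ a b := by
  obtain ⟨γ, hγ, -, hγ0, hlim, rfl⟩ := hR
  -- Points of energy at most `max a b` lie in the box with these half-sides, so a larger sup norm
  -- forces a larger energy; at the origin the energy is `0`.
  obtain ⟨x₁, hx₁, hbig⟩ := ((eventually_ge_atTop (0 : ℝ)).and
    (hlim.eventually_gt_atTop (max (xPlus p μ (max a b)) √(2 * max a b)))).exists
  have hge : max a b ≤ energy p μ (γ x₁) := by
    by_contra! h
    refine hbig.not_ge ?_
    rw [Prod.norm_def]
    exact max_le_max (abs_fst_le_xPlus hp hμ h.le) (abs_snd_le_sqrt hp hμ h.le)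
  have hγ' : ContinuousOn γ (Icc 0 x₁) := hγ.mono Icc_subset_Ici_self
  obtain ⟨r, hr, r0, r1, hrm⟩ := exists_reparam (g := fun x => energy p μ (γ x)) hx₁
    ((continuous_energy hp μ).comp_continuousOn hγ') (a := a) (b := b)
    (by rw [hγ0, energy_zero hp]; exact (lt_min ha hb).le) hge
  exact ⟨γ ∘ r, hγ'.comp_continuous hr fun σ => (hrm σ).1, r0, r1, fun σ =>
    ⟨⟨r σ, (hrm σ).1.1, rfl⟩, (hrm σ).2⟩⟩

/-! ### Twist -/

/-- The uniform angle after time `τ` of a motion starting at a point of the `k`-th quadrant. -/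
noncomputable def endAngle (p μ : ℝ) (k : ℕ) (τ : ℝ) (z : ℝ × ℝ) : ℝ :=
  sectorAngle p μ k z + angularSpeed p μ (energy p μ z) * τ

theorem continuousOn_endAngle {p μ : ℝ} (hp : 0 < p) (hμ : 0 < μ) (k : ℕ) (τ : ℝ) :
    ContinuousOn (endAngle p μ k τ) {z | 0 < energy p μ z} :=
  (continuousOn_sectorAngle hp hμ k).add (((continuousOn_angularSpeed hp hμ).comp
    (continuous_energy hp μ).continuousOn fun _ hz => hz).mul continuousOn_const)

/-- The factor `4` converts periods into quarter turns. -/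
theorem angularSpeed_mul_lt {p μ c τ x : ℝ} (hp : 0 < p) (hμ : 0 < μ) (hc : 0 < c)
    (h : τ < x * period p μ (xPlus p μ c)) : angularSpeed p μ c * τ < 4 * x := by
  have hT := period_xPlus_pos hp hμ hc
  rw [angularSpeed, div_mul_eq_mul_div, div_lt_iff₀ hT]
  linarith

theorem lt_angularSpeed_mul {p μ c τ x : ℝ} (hp : 0 < p) (hμ : 0 < μ) (hc : 0 < c)
    (h : x * period p μ (xPlus p μ c) < τ) : 4 * x < angularSpeed p μ c * τ := by
  have hT := period_xPlus_pos hp hμ hc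
  rw [angularSpeed, div_mul_eq_mul_div, lt_div_iff₀ hT]
  linarith

/-- Subpath of a path across an annulus whose end angles sweep a given sector. -/
theorem exists_sector_crossing {p μ d e τ : ℝ} (hp : 0 < p) (hμ : 0 < μ) (hd : 0 < d) (he : 0 < e)
    {k K : ℕ} {Z : ℝ → ℝ × ℝ} (hZ : Continuous Z) (hmem : ∀ σ, Z σ ∈ annulus p μ d e)
    (h0 : endAngle p μ k τ (Z 0) ≤ K) (h1 : K + 1 ≤ endAngle p μ k τ (Z 1)) :
    ∃ r : ℝ → ℝ, Continuous r ∧ endAngle p μ k τ (Z (r 0)) = K ∧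
      endAngle p μ k τ (Z (r 1)) = K + 1 ∧
      ∀ σ, endAngle p μ k τ (Z (r σ)) ∈ Icc (K : ℝ) (K + 1) := by
  have hc : Continuous fun σ => endAngle p μ k τ (Z σ) :=
    (continuousOn_endAngle hp hμ k τ).comp_continuous hZ
      fun σ => annulus_energy_pos hd he (hmem σ)
  obtain ⟨r, hr, r0, r1, hrm⟩ := exists_reparam_of_le zero_le_one hc.continuousOn
    (a := (K : ℝ)) (b := K + 1) (by linarith) h0 h1
  exact ⟨r, hr, r0, r1, fun σ => (hrm σ).2⟩

/-- A path whose end angles sweep a sector meets, after the motion, any path that crosses the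
annulus inside this sector. -/
theorem exists_meeting {p μ d e τ : ℝ} (hp : 0 < p) (hμ : 0 < μ) (hd : 0 < d) (he : 0 < e)
    {k K : ℕ} {Z Y : ℝ → ℝ × ℝ} (hZ : Continuous Z) (hmem : ∀ σ, Z σ ∈ annulus p μ d e)
    (h0 : endAngle p μ k τ (Z 0) ≤ K) (h1 : K + 1 ≤ endAngle p μ k τ (Z 1))
    (hY : Continuous Y) (hYmem : ∀ σ, Y σ ∈ annulus p μ d e ∩ (clockwiseQuadrant K).carrier)
    (hY0 : energy p μ (Y 0) = min d e) (hY1 : energy p μ (Y 1) = max d e) :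
    ∃ σ σ', endAngle p μ k τ (Z σ) ∈ Icc (K : ℝ) (K + 1) ∧
      polar p μ (energy p μ (Z σ)) (endAngle p μ k τ (Z σ)) = Y σ' := by
  have hE := continuous_energy hp μ
  have hc : Continuous fun σ => endAngle p μ k τ (Z σ) :=
    (continuousOn_endAngle hp hμ k τ).comp_continuous hZ
      fun σ => annulus_energy_pos hd he (hmem σ)
  have hs : Continuous fun σ => sectorAngle p μ K (Y σ) :=
    (continuousOn_sectorAngle hp hμ K).comp_continuous hY
      fun σ => annulus_energy_pos hd he (hYmem σ).1
  -- The first variable runs along `Z`, the second along `Y`. The angle difference changes sign in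
  -- the first because `Z` sweeps the sector containing `Y`; the energy difference changes sign in
  -- the second because `Y` crosses the annulus containing `Z`.
  obtain ⟨z, hz1, hz2⟩ := exists_common_zero
    (f := fun w => endAngle p μ k τ (Z w.1) - sectorAngle p μ K (Y w.2))
    (g := fun w => energy p μ (Y w.2) - energy p μ (Z w.1))
    ((hc.comp continuous_fst).sub (hs.comp continuous_snd)) (by fun_prop)
    (fun y => by linarith [(sectorAngle_mem (μ := μ) hp K (Y y)).1])
    (fun y => by linarith [(sectorAngle_mem (μ := μ) hp K (Y y)).2])
    (fun x => by linarith [(hmem x).1]) (fun x => by linarith [(hmem x).2])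
  rw [sub_eq_zero] at hz1 hz2
  refine ⟨z.1, z.2, ?_, ?_⟩
  · rw [hz1]; exact sectorAngle_mem hp K _
  · rw [hz1, ← hz2]
    exact polar_sectorAngle hp hμ (annulus_energy_pos hd he (hYmem _).1) (hYmem _).2

/-! ### Free motion -/

/-- Free motion of a phase point during the time `τ`. -/
def drift (τ : ℝ) (z : ℝ × ℝ) : ℝ × ℝ := (z.1 + τ * z.2, z.2)

theorem drift_neg (τ : ℝ) (z : ℝ × ℝ) : drift τ (-z) = -drift τ z := by
  ext <;> simp [drift]; ring

theorem neg_mem_annulus {p μ d e : ℝ} {z : ℝ × ℝ} :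
    -z ∈ annulus p μ d e ↔ z ∈ annulus p μ d e := by
  simp [annulus, energy_neg]

section Gap

variable {p μ₁ μ₂ d₁ e₁ d₂ e₂ τ : ℝ}

theorem gap_mul_sqrt (hd₁ : 0 < d₁) (he₁ : 0 < e₁) (hd₂ : 0 < d₂) (he₂ : 0 < e₂)
    (hgap : (xPlus p μ₁ (max d₁ e₁) + xPlus p μ₂ (max d₂ e₂)) /
      √(2 * min (min d₁ e₁) (min d₂ e₂)) ≤ τ) :
    xPlus p μ₁ (max d₁ e₁) + xPlus p μ₂ (max d₂ e₂) ≤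
      τ * √(2 * min (min d₁ e₁) (min d₂ e₂)) := by
  have : 0 < min (min d₁ e₁) (min d₂ e₂) := by positivity
  rwa [div_le_iff₀ (by positivity)] at hgap

theorem gap_time_pos (hp : 0 < p) (hμ₁ : 0 < μ₁) (hμ₂ : 0 < μ₂)
    (hd₁ : 0 < d₁) (he₁ : 0 < e₁) (hd₂ : 0 < d₂) (he₂ : 0 < e₂)
    (hgap : (xPlus p μ₁ (max d₁ e₁) + xPlus p μ₂ (max d₂ e₂)) /
      √(2 * min (min d₁ e₁) (min d₂ e₂)) ≤ τ) : 0 < τ := by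
  refine lt_of_lt_of_le ?_ hgap
  have h1 := xPlus_pos hp hμ₁ (c := max d₁ e₁) (lt_max_of_lt_left hd₁)
  have h2 := xPlus_pos hp hμ₂ (c := max d₂ e₂) (lt_max_of_lt_left hd₂)
  have h3 : 0 < min (min d₁ e₁) (min d₂ e₂) := by positivity
  positivity

/-- A point of the annulus in the second quadrant that has not crossed the `y`-axis during the gap
has small speed. -/
theorem half_sq_lt_of_drift_nonpos (hp : 0 < p) (hμ₁ : 0 < μ₁) (hμ₂ : 0 < μ₂)
    (hd₁ : 0 < d₁) (he₁ : 0 < e₁) (hd₂ : 0 < d₂) (he₂ : 0 < e₂)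
    (hgap : (xPlus p μ₁ (max d₁ e₁) + xPlus p μ₂ (max d₂ e₂)) /
      √(2 * min (min d₁ e₁) (min d₂ e₂)) ≤ τ) {w : ℝ × ℝ} (hw : w ∈ annulus p μ₁ d₁ e₁)
    (hw2 : 0 ≤ w.2) (h : (drift τ w).1 ≤ 0) : w.2 ^ 2 / 2 < min d₂ e₂ := by
  have hτ := gap_time_pos hp hμ₁ hμ₂ hd₁ he₁ hd₂ he₂ hgap
  have h1 := gap_mul_sqrt hd₁ he₁ hd₂ he₂ hgap
  have h2 := xPlus_pos hp hμ₂ (c := max d₂ e₂) (lt_max_of_lt_left hd₂)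
  have h3 := (abs_le.1 (abs_fst_le_xPlus hp hμ₁ hw.2)).1
  have h4 : τ * w.2 < τ * √(2 * min (min d₁ e₁) (min d₂ e₂)) := by
    simp only [drift] at h; linarith
  have h5 := lt_of_mul_lt_mul_left h4 hτ.le
  rw [Real.lt_sqrt hw2] at h5
  have := min_le_right (min d₁ e₁) (min d₂ e₂)
  linarith

/-- On the `y`-axis all the energy is kinetic. -/
theorem sqrt_le_snd (hp : 0 < p) {w : ℝ × ℝ} (hw : w ∈ annulus p μ₁ d₁ e₁)
    (hw2 : 0 ≤ w.2) (h : w.1 = 0) : √(2 * min (min d₁ e₁) (min d₂ e₂)) ≤ w.2 := by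
  rw [Real.sqrt_le_left hw2]
  have h1 := hw.1
  rw [energy_of_fst_eq_zero hp _ h] at h1
  have := min_le_left (min d₁ e₁) (min d₂ e₂)
  linarith

/-- A point starting on the `y`-axis would drift beyond the second annulus; a point ending on it
would be too slow for that annulus. Hence both inequalities are strict. -/
theorem gap_signs (hp : 0 < p) (hμ₁ : 0 < μ₁) (hμ₂ : 0 < μ₂)
    (hd₁ : 0 < d₁) (he₁ : 0 < e₁) (hd₂ : 0 < d₂) (he₂ : 0 < e₂)
    (hgap : (xPlus p μ₁ (max d₁ e₁) + xPlus p μ₂ (max d₂ e₂)) /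
      √(2 * min (min d₁ e₁) (min d₂ e₂)) ≤ τ) {w : ℝ × ℝ}
    (hw : w ∈ annulus p μ₁ d₁ e₁ ∩ Quadrant.II.carrier)
    (hz : drift τ w ∈ annulus p μ₂ d₂ e₂ ∩ Quadrant.I.carrier) :
    w.1 < 0 ∧ 0 < (drift τ w).1 ∧ 0 < w.2 := by
  have hτ := gap_time_pos hp hμ₁ hμ₂ hd₁ he₁ hd₂ he₂ hgap
  have h1 := gap_mul_sqrt hd₁ he₁ hd₂ he₂ hgap
  obtain ⟨hw, hw1, hw2⟩ := hw
  obtain ⟨hz, hz1, -⟩ := hz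
  have a1 : w.1 < 0 := by
    refine lt_of_le_of_ne hw1 fun h => ?_
    have h2 := sqrt_le_snd (d₂ := d₂) (e₂ := e₂) hp hw hw2 h
    have h3 := (abs_le.1 (abs_fst_le_xPlus hp hμ₂ hz.2)).2
    have h4 := xPlus_pos hp hμ₁ (c := max d₁ e₁) (lt_max_of_lt_left hd₁)
    have h5 : τ * √(2 * min (min d₁ e₁) (min d₂ e₂)) ≤ τ * w.2 := by gcongr
    simp only [drift, h, zero_add] at h3
    linarith
  have a2 : 0 < (drift τ w).1 := by
    refine lt_of_le_of_ne hz1 fun h => ?_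
    have h2 := half_sq_lt_of_drift_nonpos hp hμ₁ hμ₂ hd₁ he₁ hd₂ he₂ hgap hw hw2 h.ge
    have h3 := hz.1
    rw [energy_of_fst_eq_zero hp _ h.symm] at h3
    simp only [drift] at h3
    linarith
  refine ⟨a1, a2, ?_⟩
  simp only [drift] at a2
  by_contra! h
  nlinarith

theorem exists_gap_crossing_of_second (hp : 0 < p) (hμ₁ : 0 < μ₁) (hμ₂ : 0 < μ₂)
    (hd₁ : 0 < d₁) (he₁ : 0 < e₁) (hd₂ : 0 < d₂) (he₂ : 0 < e₂)
    (hgap : (xPlus p μ₁ (max d₁ e₁) + xPlus p μ₂ (max d₂ e₂)) /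
      √(2 * min (min d₁ e₁) (min d₂ e₂)) ≤ τ) {W : ℝ → ℝ × ℝ} (hW : Continuous W)
    (hmem : ∀ σ, W σ ∈ annulus p μ₁ d₁ e₁ ∩ Quadrant.II.carrier)
    (h0 : (W 0).2 = 0) (h1 : (W 1).1 = 0) :
    ∃ r : ℝ → ℝ, Continuous r ∧ energy p μ₂ (drift τ (W (r 0))) = d₂ ∧
      energy p μ₂ (drift τ (W (r 1))) = e₂ ∧
      ∀ σ, drift τ (W (r σ)) ∈ annulus p μ₂ d₂ e₂ ∩ Quadrant.I.carrier := by
  have hτ := gap_time_pos hp hμ₁ hμ₂ hd₁ he₁ hd₂ he₂ hgap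
  -- Projecting the points still left of the `y`-axis onto it leaves them with energy below `min d₂
  -- e₂`. A subpath of `D` with energies in the annulus thus avoids them, and there `D` is the true
  -- drift.
  let D : ℝ → ℝ × ℝ := fun σ => (max 0 (drift τ (W σ)).1, (W σ).2)
  have hD : Continuous D := by simp only [D, drift]; fun_prop
  have hsmall : ∀ σ, (drift τ (W σ)).1 ≤ 0 → energy p μ₂ (D σ) < min d₂ e₂ := by
    intro σ h
    rw [energy_of_fst_eq_zero hp _ (show (D σ).1 = 0 from max_eq_left h)]
    exact half_sq_lt_of_drift_nonpos (w := W σ) hp hμ₁ hμ₂ hd₁ he₁ hd₂ he₂ hgap (hmem σ).1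
      (hmem σ).2.2 h
  have hlarge : max d₂ e₂ ≤ energy p μ₂ (D 1) := by
    refine le_energy_of_xPlus_le hp hμ₂ (lt_max_of_lt_left hd₂) ?_
    refine le_trans ?_ ((le_max_right 0 (drift τ (W 1)).1).trans (le_abs_self _))
    have h2 := sqrt_le_snd (d₂ := d₂) (e₂ := e₂) hp (hmem 1).1 (hmem 1).2.2 h1
    have h3 := gap_mul_sqrt hd₁ he₁ hd₂ he₂ hgap
    have h4 := xPlus_pos hp hμ₁ (c := max d₁ e₁) (lt_max_of_lt_left hd₁)
    have h5 : τ * √(2 * min (min d₁ e₁) (min d₂ e₂)) ≤ τ * (W 1).2 := by gcongr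
    simp only [drift, h1, zero_add]
    linarith
  have hz : (drift τ (W 0)).1 ≤ 0 := by
    simp only [drift, h0, mul_zero, add_zero]
    exact (hmem 0).2.1
  obtain ⟨r, hr, r0, r1, hrm⟩ := exists_reparam (g := fun σ => energy p μ₂ (D σ)) zero_le_one
    ((continuous_energy hp μ₂).comp hD).continuousOn (hsmall 0 hz).le hlarge
  have hpos : ∀ σ, 0 < (drift τ (W (r σ))).1 := by
    intro σ
    by_contra! h
    exact (hsmall _ h).not_ge (hrm σ).2.1
  have heq : ∀ σ, D (r σ) = drift τ (W (r σ)) := fun σ =>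
    Prod.ext (max_eq_right (hpos σ).le) rfl
  simp only [heq] at r0 r1 hrm
  exact ⟨r, hr, r0, r1, fun σ => ⟨(hrm σ).2, (hpos σ).le, (hmem _).2.2⟩⟩

/-- Free motion stretches a path across the second quadrant of an annulus to a path across the first
quadrant of the next annulus; likewise from the fourth quadrant to the third. -/
theorem exists_gap_crossing (hp : 0 < p) (hμ₁ : 0 < μ₁) (hμ₂ : 0 < μ₂)
    (hd₁ : 0 < d₁) (he₁ : 0 < e₁) (hd₂ : 0 < d₂) (he₂ : 0 < e₂)
    (hgap : (xPlus p μ₁ (max d₁ e₁) + xPlus p μ₂ (max d₂ e₂)) /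
      √(2 * min (min d₁ e₁) (min d₂ e₂)) ≤ τ) {W : ℝ → ℝ × ℝ} (hW : Continuous W) (b : Bool)
    (hmem : ∀ σ, W σ ∈ annulus p μ₁ d₁ e₁ ∩
      Quadrant.carrier (if b then Quadrant.II else Quadrant.IV))
    (h0 : (W 0).2 = 0) (h1 : (W 1).1 = 0) :
    ∃ r : ℝ → ℝ, Continuous r ∧ energy p μ₂ (drift τ (W (r 0))) = d₂ ∧
      energy p μ₂ (drift τ (W (r 1))) = e₂ ∧
      ∀ σ, drift τ (W (r σ)) ∈ annulus p μ₂ d₂ e₂ ∩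
        Quadrant.carrier (if b then Quadrant.I else Quadrant.III) := by
  cases b
  · obtain ⟨r, hr, r0, r1, hrm⟩ := exists_gap_crossing_of_second hp hμ₁ hμ₂ hd₁ he₁ hd₂ he₂ hgap
      (W := fun σ => -W σ) hW.neg (fun σ => ⟨neg_mem_annulus.2 (hmem σ).1, by
        simpa [Quadrant.carrier] using (hmem σ).2⟩) (by simpa using h0) (by simpa using h1)
    simp only [drift_neg, energy_neg] at r0 r1 hrm
    refine ⟨r, hr, r0, r1, fun σ => ⟨neg_mem_annulus.1 (hrm σ).1, ?_⟩⟩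
    simpa [Quadrant.carrier] using (hrm σ).2
  · exact exists_gap_crossing_of_second hp hμ₁ hμ₂ hd₁ he₁ hd₂ he₂ hgap hW hmem h0 h1

theorem gap_products (hp : 0 < p) (hμ₁ : 0 < μ₁) (hμ₂ : 0 < μ₂)
    (hd₁ : 0 < d₁) (he₁ : 0 < e₁) (hd₂ : 0 < d₂) (he₂ : 0 < e₂)
    (hgap : (xPlus p μ₁ (max d₁ e₁) + xPlus p μ₂ (max d₂ e₂)) /
      √(2 * min (min d₁ e₁) (min d₂ e₂)) ≤ τ) {w : ℝ × ℝ} (b : Bool)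
    (hw : w ∈ annulus p μ₁ d₁ e₁ ∩ Quadrant.carrier (if b then Quadrant.II else Quadrant.IV))
    (hz : drift τ w ∈ annulus p μ₂ d₂ e₂ ∩
      Quadrant.carrier (if b then Quadrant.I else Quadrant.III)) :
    w.1 * w.2 < 0 ∧ 0 < (drift τ w).1 * w.2 := by
  cases b
  · obtain ⟨h1, h2, h3⟩ := gap_signs hp hμ₁ hμ₂ hd₁ he₁ hd₂ he₂ hgap (w := -w)
      ⟨neg_mem_annulus.2 hw.1, by simpa [Quadrant.carrier] using hw.2⟩
      (by rw [drift_neg]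
          exact ⟨neg_mem_annulus.2 hz.1, by simpa [Quadrant.carrier] using hz.2⟩)
    rw [drift_neg] at h2
    simp only [Prod.fst_neg, Prod.snd_neg] at h1 h2 h3
    constructor <;> nlinarith
  · obtain ⟨h1, h2, h3⟩ := gap_signs hp hμ₁ hμ₂ hd₁ he₁ hd₂ he₂ hgap hw hz
    exact ⟨mul_neg_of_neg_of_pos h1 h3, mul_pos h2 h3⟩

end Gap

/-! ### Extension of solutions -/

/-- The behaviour of a solution on an interval `[T, S]` where the weight is positive. -/
structure LapPattern (p μ d e T S : ℝ) (q q' : Quadrant) (N : ℕ) (u v : ℝ → ℝ) : Prop where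
  start_mem : (u T, v T) ∈ annulus p μ d e ∩ q.carrier
  end_mem : (u S, v S) ∈ annulus p μ d e ∩ q'.carrier
  zeros : {x ∈ countingInterval q q' T S | u x = 0}.encard = ((2 * N + offset q q' : ℕ) : ℕ∞)

/-- The behaviour of a solution on an interval `[S, T]` where the weight vanishes. -/
structure GapPattern (S T : ℝ) (u v : ℝ → ℝ) : Prop where
  zeros : {x ∈ Ioo S T | u x = 0}.encard = 1
  deriv : ∀ x ∈ Icc S T, v x ≠ 0

theorem LapPattern.congr {p μ d e T S A : ℝ} {q q' : Quadrant} {N : ℕ} {u v u' v' : ℝ → ℝ}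
    (h : LapPattern p μ d e T S q q' N u v) (hTS : T ≤ S) (hS : S ≤ A) (hu : EqOn u u' (Iic A))
    (hv : EqOn v v' (Iic A)) : LapPattern p μ d e T S q q' N u' v' := by
  refine ⟨?_, ?_, ?_⟩
  · rw [← hu (hTS.trans hS), ← hv (hTS.trans hS)]; exact h.start_mem
  · rw [← hu hS, ← hv hS]; exact h.end_mem
  · rw [← h.zeros]
    congr 1
    ext x
    refine and_congr_right fun hx => ?_
    rw [hu (hx.2.1.trans hS)]

theorem GapPattern.congr {S T A : ℝ} {u v u' v' : ℝ → ℝ} (h : GapPattern S T u v) (hT : T ≤ A)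
    (hu : EqOn u u' (Iic A)) (hv : EqOn v v' (Iic A)) : GapPattern S T u' v' := by
  refine ⟨?_, fun x hx => ?_⟩
  · rw [← h.zeros]
    congr 1
    ext x
    refine and_congr_right fun hx => ?_
    rw [hu (hx.2.le.trans hT)]
  · rw [← hv (hx.2.trans hT)]; exact h.deriv x hx

/-- The continuation is the uniform rotation issuing from `(u T, v T)`; the sector of its final
angle fixes both the quadrant reached and the number of zeros. -/
theorem PiecewiseSolution.exists_extend_lap {p : ℝ} {a : ℝ → ℝ} {A T S μ d e : ℝ}
    (hp : 0 < p) (hμ : 0 < μ) (hd : 0 < d) (he : 0 < e) (hTS : T < S)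
    (ha : ∀ x ∈ Ioo T S, a x = μ) {q q' : Quadrant} {N : ℕ} {u v : ℝ → ℝ}
    (h : PiecewiseSolution p a A T u v)
    (hz : (u T, v T) ∈ annulus p μ d e ∩ q.carrier)
    (hΘ : endAngle p μ q.index (S - T) (u T, v T) ∈
      Icc ((q.index + 4 * N + sweep q q' : ℕ) : ℝ) ((q.index + 4 * N + sweep q q' : ℕ) + 1)) :
    ∃ u' v', PiecewiseSolution p a A S u' v' ∧ EqOn u u' (Iic T) ∧ EqOn v v' (Iic T) ∧
      LapPattern p μ d e T S q q' N u' v' ∧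
      (u' S, v' S) = polar p μ (energy p μ (u T, v T))
        (endAngle p μ q.index (S - T) (u T, v T)) := by
  set c := energy p μ (u T, v T) with hc
  have hc0 : 0 < c := annulus_energy_pos hd he hz.1
  set θ := sectorAngle p μ q.index (u T, v T) with hθ
  have hΘeq : endAngle p μ q.index (S - T) (u T, v T) = θ + angularSpeed p μ c * (S - T) := rfl
  have hpol : polar p μ c θ = (u T, v T) :=
    polar_sectorAngle hp hμ hc0 (by rw [clockwiseQuadrant_index]; exact hz.2)
  let P : ℝ → ℝ × ℝ := fun x => polar p μ c (θ + angularSpeed p μ c * (x - T))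
  have hPT : P T = (u T, v T) := by simp only [P, sub_self, mul_zero, add_zero, hpol]
  have hPc : Continuous P :=
    (continuous_polar hp μ).comp (f := fun x => (c, θ + angularSpeed p μ c * (x - T)))
      (by fun_prop)
  have hsol : PiecewiseSolution p a T S (fun x => (P x).1) (fun x => (P x).2) := by
    refine ⟨hPc.fst, hPc.snd, ∅, finite_empty, fun x hx => ⟨hasDerivAt_polar_fst hp hμ hc0 _ _ _, ?_⟩⟩
    rw [ha x hx.1]
    exact hasDerivAt_polar_snd hp hμ hc0 _ _ _
  have hg := h.glue hsol (by simp [hPT]) (by simp [hPT])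
  have hS : ¬ S ≤ T := not_le.2 hTS
  refine ⟨_, _, hg, fun x hx => ?_, fun x hx => ?_, ⟨?_, ?_, ?_⟩, ?_⟩
  · exact (if_pos hx).symm
  · exact (if_pos hx).symm
  · simpa using hz
  · simp only [hS, if_false]
    have hE : energy p μ (P S) = c := energy_polar hp hμ hc0 _
    refine ⟨⟨by rw [hE]; exact hz.1.1, by rw [hE]; exact hz.1.2⟩, ?_⟩
    have := polar_mem hp hμ hc0 hΘ
    rwa [show q.index + 4 * N + sweep q q' = q.index + sweep q q' + 4 * N by ring,
      clockwiseQuadrant_add_four_mul, clockwiseQuadrant_sweep] at this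
  · refine encard_zeros_gsin (r := p + 1) (by linarith) (xPlus_pos hp hμ hc0)
      (angularSpeed_pos hp hμ hc0) (sectorAngle_mem hp _ _) hΘ fun x hx => ?_
    rcases hx.1.eq_or_lt with rfl | hlt
    · simp only [le_refl, if_true]
      exact (congrArg Prod.fst hPT).symm
    · simp only [hlt.not_ge, if_false]
      rfl
  · simp only [hS, if_false]
    rfl

/-- The continuation is affine, with its only zero at `S - u S / v S`; the two sign conditions place
it strictly between `S` and `T`. -/
theorem PiecewiseSolution.exists_extend_gap {p : ℝ} {a : ℝ → ℝ} {A S T : ℝ} (hST : S < T)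
    (ha : ∀ x ∈ Ioo S T, a x = 0) {u v : ℝ → ℝ} (h : PiecewiseSolution p a A S u v)
    (h1 : u S * v S < 0) (h2 : 0 < (drift (T - S) (u S, v S)).1 * v S) :
    ∃ u' v', PiecewiseSolution p a A T u' v' ∧ EqOn u u' (Iic S) ∧ EqOn v v' (Iic S) ∧
      GapPattern S T u' v' ∧ (u' T, v' T) = drift (T - S) (u S, v S) := by
  have hv0 : v S ≠ 0 := fun h => by simp [h] at h1
  have hsol : PiecewiseSolution p a S T (fun x => u S + (x - S) * v S) (fun _ => v S) := by
    refine ⟨by fun_prop, continuous_const, ∅, finite_empty, fun x hx => ⟨?_, ?_⟩⟩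
    · simpa using (((hasDerivAt_id x).sub_const S).mul_const (v S)).const_add (u S)
    · rw [ha x hx.1, zero_mul, neg_zero]
      exact hasDerivAt_const _ _
  have hg := h.glue hsol (by simp) rfl
  have hT : ¬ T ≤ S := not_le.2 hST
  refine ⟨_, _, hg, fun x hx => (if_pos hx).symm, fun x hx => (if_pos hx).symm, ⟨?_, ?_⟩, ?_⟩
  · rw [encard_eq_one]
    refine ⟨S - u S / v S, ?_⟩
    have hsq : 0 < v S ^ 2 := by positivity
    have e1 : u S / v S = u S * v S / v S ^ 2 := by field_simp
    have hlt1 : u S / v S < 0 := by rw [e1]; exact div_neg_of_neg_of_pos h1 hsq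
    have hlt2 : 0 < T - S + u S / v S := by
      have : T - S + u S / v S = (drift (T - S) (u S, v S)).1 * v S / v S ^ 2 := by
        simp only [drift]; field_simp; ring
      rw [this]; positivity
    ext x
    simp only [mem_ofPred_eq, mem_singleton_iff, mem_Ioo]
    constructor
    · rintro ⟨⟨hx1, hx2⟩, hx3⟩
      rw [if_neg (not_le.2 hx1)] at hx3
      have : x - S = -(u S / v S) := by field_simp; linarith
      linarith
    · rintro rfl
      refine ⟨⟨by linarith, by linarith⟩, ?_⟩
      rw [if_neg (not_le.2 (by linarith))]
      field_simp
      ring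
  · intro x hx
    rcases hx.1.eq_or_lt with rfl | hlt
    · simpa using hv0
    · simpa [hlt.not_ge] using hv0
  · simp [hT, drift]

/-! ### Itineraries -/

namespace Itinerary

variable {m : ℕ} {n : Fin (m + 1) → ℕ} (ι : Itinerary m n)

theorem startQuadrant_succ (q₀ : Quadrant) (i : Fin m) :
    ι.startQuadrant q₀ i.succ = if ι.entersFirst i then .I else .III := rfl

theorem endQuadrant_last (qL : Quadrant) : ι.endQuadrant qL (Fin.last m) = qL :=
  Fin.lastCases_last

theorem endQuadrant_castSucc (qL : Quadrant) (i : Fin m) :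
    ι.endQuadrant qL i.castSucc = if ι.entersFirst i then .II else .IV :=
  Fin.lastCases_castSucc _

/-- The sweep is `2` only between opposite quadrants, whereas an inner interval leads from I or III
to II or IV. This extra quarter turn is why `1 / 2` suffices in `twist_inner` where `twist_outer`
has `1 / 4`. -/
theorem three_le_sweep (q₀ qL : Quadrant) {i : Fin (m + 1)} (h0 : i ≠ 0) (hm : i ≠ Fin.last m) :
    3 ≤ sweep (ι.startQuadrant q₀ i) (ι.endQuadrant qL i) := by
  obtain ⟨j, hj⟩ := Fin.exists_succ_eq.2 h0
  obtain ⟨l, hl⟩ := Fin.exists_castSucc_eq.2 hm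
  have h1 := ι.startQuadrant_succ q₀ j
  have h2 := ι.endQuadrant_castSucc qL l
  rw [hj] at h1
  rw [hl] at h2
  rw [h1, h2]
  split_ifs <;> decide

/-- Itineraries as pairs of functions. -/
def equivProd : Itinerary m n ≃ (Fin m → Bool) × (∀ i, Fin (n i)) where
  toFun ι := (ι.entersFirst, ι.lap)
  invFun w := ⟨w.1, w.2⟩
  left_inv _ := rfl
  right_inv _ := rfl

theorem enatCard_eq : ENat.card (Itinerary m n) = ((2 ^ m * ∏ i, n i : ℕ) : ℕ∞) := by
  rw [ENat.card_congr equivProd, ENat.card_eq_coe_fintype_card]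
  simp

end Itinerary

theorem gcos_natCast_of_odd {q : ℝ} (hq : 0 < q) {n : ℕ} (hn : n % 2 = 1) : gcos q n = 0 := by
  obtain ⟨l, rfl⟩ : ∃ l, n = 2 * l + 1 := ⟨n / 2, by omega⟩
  unfold gcos
  rw [polarAngle_natCast hq]
  push_cast
  rw [show (2 * (l : ℝ) + 1) * (Real.pi / 2) = l * Real.pi + Real.pi / 2 by ring,
    Real.cos_add_pi_div_two, Real.sin_nat_mul_pi, neg_zero]

theorem gsin_natCast_of_even {q : ℝ} (hq : 0 < q) {n : ℕ} (hn : n % 2 = 0) : gsin q n = 0 := by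
  refine (gsin_eq_zero_iff hq n.cast_nonneg).2 ⟨n / 2, ?_⟩
  exact_mod_cast (show n = 2 * (n / 2) by omega)

/-! ### The data of the problem -/

/-- The hypotheses on times, weights, energies and windings. -/
structure TwistData (m : ℕ) (p : ℝ) (t s μ d e : Fin (m + 1) → ℝ) (α β : Fin (m + 1) → ℕ) :
    Prop where
  hp : 0 < p
  ht0 : t 0 = 0
  hts : ∀ i, t i < s i
  hst : ∀ i : Fin m, s i.castSucc < t i.succ
  hμ : ∀ i, 0 < μ i
  hd : ∀ i, 0 < d i
  he : ∀ i, 0 < e i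
  twist_inner : ∀ i, i ≠ 0 → i ≠ Fin.last m →
    s i - t i < (α i + 1 / 2) * period p (μ i) (xPlus p (μ i) (d i)) ∧
    (β i + 1 / 2) * period p (μ i) (xPlus p (μ i) (e i)) < s i - t i
  twist_outer : ∀ i, i = 0 ∨ i = Fin.last m →
    s i - t i < (α i + 1 / 4) * period p (μ i) (xPlus p (μ i) (d i)) ∧
    (β i + 1 / 2) * period p (μ i) (xPlus p (μ i) (e i)) < s i - t i
  gap : ∀ i : Fin m,
    (xPlus p (μ i.castSucc) (max (d i.castSucc) (e i.castSucc)) +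
        xPlus p (μ i.succ) (max (d i.succ) (e i.succ))) /
      √(2 * min (min (d i.castSucc) (e i.castSucc)) (min (d i.succ) (e i.succ)))
      ≤ t i.succ - s i.castSucc

/-- A solution up to time `t i` with the behaviour prescribed by an itinerary up to that time. -/
structure PrefixSolution {m : ℕ} (p : ℝ) (t s μ d e : Fin (m + 1) → ℝ) (α β : Fin (m + 1) → ℕ)
    (q₀ qL : Quadrant) (ι : Itinerary m fun i => β i - α i) (R₀ : Set (ℝ × ℝ)) (i : Fin (m + 1))
    (u v : ℝ → ℝ) : Prop where
  sol : PiecewiseSolution p (stepWeight t s μ) 0 (t i) u v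
  init : (u 0, v 0) ∈ R₀
  lap : ∀ j, j < i → LapPattern p (μ j) (d j) (e j) (t j) (s j) (ι.startQuadrant q₀ j)
    (ι.endQuadrant qL j) (α j + ι.lap j) u v
  gap : ∀ j : Fin m, j.succ ≤ i → GapPattern (s j.castSucc) (t j.succ) u v

/-! ### Stretching along an itinerary and the final meeting -/

section Main

variable {m : ℕ} {p : ℝ} {t s μ d e : Fin (m + 1) → ℝ} {α β : Fin (m + 1) → ℕ}
  {q₀ qL : Quadrant} {R₀ RL : Set (ℝ × ℝ)}

/-- The lower end of the sector of angles that the itinerary prescribes at time `s i`. -/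
def targetSector (q₀ qL : Quadrant) (ι : Itinerary m fun i => β i - α i) (i : Fin (m + 1)) : ℕ :=
  (ι.startQuadrant q₀ i).index + 4 * (α i + ι.lap i) +
    sweep (ι.startQuadrant q₀ i) (ι.endQuadrant qL i)

theorem clockwiseQuadrant_targetSector (ι : Itinerary m fun i => β i - α i) (i : Fin (m + 1)) :
    clockwiseQuadrant (targetSector q₀ qL ι i) = ι.endQuadrant qL i := by
  rw [targetSector, add_right_comm, clockwiseQuadrant_add_four_mul, clockwiseQuadrant_sweep]

theorem TwistData.start_nonneg (D : TwistData m p t s μ d e α β) (i : Fin (m + 1)) : 0 ≤ t i := by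
  rw [← D.ht0]; exact (strictMono_start D.hts D.hst).monotone (Fin.zero_le i)

/-- Even from the far end `k + 1` of its sector, a point turning by less than `4 * α i + 1` stays
below `k + 4 * α i + 2`; for inner intervals the bounds are `4 * α i + 2` and `k + 4 * α i + 3`. -/
theorem TwistData.endAngle_le (D : TwistData m p t s μ d e α β)
    (ι : Itinerary m fun i => β i - α i) (i : Fin (m + 1)) {z : ℝ × ℝ}
    (hz : energy p (μ i) z = d i) :
    endAngle p (μ i) (ι.startQuadrant q₀ i).index (s i - t i) z ≤ targetSector q₀ qL ι i := by
  have h1 := (sectorAngle_mem (μ := μ i) D.hp (ι.startQuadrant q₀ i).index z).2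
  have hlap : (0 : ℝ) ≤ ι.lap i := Nat.cast_nonneg _
  unfold endAngle targetSector
  rw [hz]
  push_cast
  by_cases hi : i = 0 ∨ i = Fin.last m
  · have h2 := angularSpeed_mul_lt D.hp (D.hμ i) (D.hd i) (D.twist_outer i hi).1
    have h3 : (2 : ℝ) ≤ sweep (ι.startQuadrant q₀ i) (ι.endQuadrant qL i) := by
      exact_mod_cast two_le_sweep _ _
    linarith
  · rw [not_or] at hi
    have h2 := angularSpeed_mul_lt D.hp (D.hμ i) (D.hd i) (D.twist_inner i hi.1 hi.2).1
    have h3 : (3 : ℝ) ≤ sweep (ι.startQuadrant q₀ i) (ι.endQuadrant qL i) := by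
      exact_mod_cast ι.three_le_sweep q₀ qL hi.1 hi.2
    linarith

/-- Even from the near end `k`, the point passes `k + 4 * β i + 2 ≥ k + 4 * (α i + ι.lap i) + 6`,
and the sweep is at most `5`. -/
theorem TwistData.le_endAngle (D : TwistData m p t s μ d e α β)
    (ι : Itinerary m fun i => β i - α i) (i : Fin (m + 1)) {z : ℝ × ℝ}
    (hz : energy p (μ i) z = e i) :
    targetSector q₀ qL ι i + 1 ≤
      endAngle p (μ i) (ι.startQuadrant q₀ i).index (s i - t i) z := by
  have h1 := (sectorAngle_mem (μ := μ i) D.hp (ι.startQuadrant q₀ i).index z).1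
  have h3 : (sweep (ι.startQuadrant q₀ i) (ι.endQuadrant qL i) : ℝ) ≤ 5 := by
    exact_mod_cast sweep_le_five _ _
  have hlap : (α i : ℝ) + ι.lap i + 1 ≤ β i := by
    have := (ι.lap i).2
    exact_mod_cast (show α i + ι.lap i + 1 ≤ β i by omega)
  have h2 : (β i + 1 / 2) * period p (μ i) (xPlus p (μ i) (e i)) < s i - t i := by
    by_cases hi : i = 0 ∨ i = Fin.last m
    · exact (D.twist_outer i hi).2
    · rw [not_or] at hi
      exact (D.twist_inner i hi.1 hi.2).2
  have h4 := lt_angularSpeed_mul D.hp (D.hμ i) (D.he i) h2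
  unfold endAngle targetSector
  rw [hz]
  push_cast
  linarith

theorem PrefixSolution.extend_lap (D : TwistData m p t s μ d e α β)
    {ι : Itinerary m fun i => β i - α i} {i : Fin (m + 1)} {u v : ℝ → ℝ}
    (h : PrefixSolution p t s μ d e α β q₀ qL ι R₀ i u v)
    (hz : (u (t i), v (t i)) ∈ annulus p (μ i) (d i) (e i) ∩ (ι.startQuadrant q₀ i).carrier)
    (hΘ : endAngle p (μ i) (ι.startQuadrant q₀ i).index (s i - t i) (u (t i), v (t i)) ∈
      Icc (targetSector q₀ qL ι i : ℝ) (targetSector q₀ qL ι i + 1)) :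
    ∃ u' v', PiecewiseSolution p (stepWeight t s μ) 0 (s i) u' v' ∧ (u' 0, v' 0) ∈ R₀ ∧
      (∀ j, j ≤ i → LapPattern p (μ j) (d j) (e j) (t j) (s j) (ι.startQuadrant q₀ j)
        (ι.endQuadrant qL j) (α j + ι.lap j) u' v') ∧
      (∀ j : Fin m, j.succ ≤ i → GapPattern (s j.castSucc) (t j.succ) u' v') ∧
      (u' (s i), v' (s i)) = polar p (μ i) (energy p (μ i) (u (t i), v (t i)))
        (endAngle p (μ i) (ι.startQuadrant q₀ i).index (s i - t i) (u (t i), v (t i))) := by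
  obtain ⟨u', v', hsol, hu, hv, hlap, hend⟩ := h.sol.exists_extend_lap D.hp (D.hμ i) (D.hd i)
    (D.he i) (D.hts i) (fun x hx => stepWeight_of_mem D.hts D.hst i hx) hz hΘ
  refine ⟨u', v', hsol, ?_, fun j hj => ?_, fun j hj => ?_, hend⟩
  · rw [← hu (D.start_nonneg i), ← hv (D.start_nonneg i)]; exact h.init
  · rcases hj.eq_or_lt with rfl | hlt
    · exact hlap
    · exact (h.lap j hlt).congr (D.hts j).le (end_le_start D.hts D.hst hlt).le hu hv
  · exact (h.gap j hj).congr ((strictMono_start D.hts D.hst).monotone hj) hu hv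

theorem exists_prefix_path (D : TwistData m p t s μ d e α β) (hR₀ : IsArcToInfinity R₀)
    (hq₀ : R₀ ⊆ q₀.carrier) (ι : Itinerary m fun i => β i - α i) (i : Fin (m + 1)) :
    ∃ Z : ℝ → ℝ × ℝ, Continuous Z ∧ energy p (μ i) (Z 0) = d i ∧ energy p (μ i) (Z 1) = e i ∧
      ∀ σ, Z σ ∈ annulus p (μ i) (d i) (e i) ∩ (ι.startQuadrant q₀ i).carrier ∧
        ∃ u v, PrefixSolution p t s μ d e α β q₀ qL ι R₀ i u v ∧ (u (t i), v (t i)) = Z σ := by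
  induction i using Fin.induction with
  | zero =>
    -- Since `t 0 = 0`, the time interval is degenerate and constant functions serve as partial
    -- solutions through the points of the arc.
    obtain ⟨Y, hY, h0, h1, hmem⟩ := hR₀.exists_path D.hp (D.hμ 0) (D.hd 0) (D.he 0)
    refine ⟨Y, hY, h0, h1, fun σ => ⟨⟨(hmem σ).2, hq₀ (hmem σ).1⟩, fun _ => (Y σ).1,
      fun _ => (Y σ).2, ⟨⟨continuous_const, continuous_const, ∅, finite_empty, ?_⟩, (hmem σ).1,
        fun j hj => absurd hj (Fin.not_lt_zero j), fun j hj => ?_⟩, rfl⟩⟩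
    · rw [D.ht0]; simp
    · exact absurd hj (not_le.2 (Fin.succ_pos j))
  | succ i ih =>
    obtain ⟨Z, hZ, h0, h1, hmem⟩ := ih
    have hp := D.hp
    have hq : 0 < p + 1 := by linarith
    set K := targetSector q₀ qL ι i.castSucc with hK
    set k := (ι.startQuadrant q₀ i.castSucc).index with hk
    set τ := s i.castSucc - t i.castSucc with hτ
    have hμ := D.hμ i.castSucc
    obtain ⟨r, hr, hr0, hr1, hrm⟩ := exists_sector_crossing hp hμ (D.hd _) (D.he _) hZ
      (fun σ => (hmem σ).1.1) (D.endAngle_le (q₀ := q₀) (qL := qL) ι i.castSucc h0)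
      (D.le_endAngle (q₀ := q₀) (qL := qL) ι i.castSucc h1)
    have hpos : ∀ σ, 0 < energy p (μ i.castSucc) (Z (r σ)) := fun σ =>
      annulus_energy_pos (D.hd _) (D.he _) (hmem (r σ)).1.1
    let W : ℝ → ℝ × ℝ := fun σ => polar p (μ i.castSucc) (energy p (μ i.castSucc) (Z (r σ)))
      (endAngle p (μ i.castSucc) k τ (Z (r σ)))
    have hW : Continuous W := (continuous_polar hp _).comp
      (((continuous_energy hp _).comp (hZ.comp hr)).prodMk
        ((continuousOn_endAngle hp hμ k τ).comp_continuous (hZ.comp hr) hpos))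
    have hquad : clockwiseQuadrant K = if ι.entersFirst i then .II else .IV := by
      rw [hK, clockwiseQuadrant_targetSector, Itinerary.endQuadrant_castSucc]
    -- The target is II or IV, so the sector begins on the `x`-axis (odd angle) and ends on the
    -- `y`-axis (even angle), as the gap crossing requires.
    have hodd : K % 2 = 1 := by
      have h2 := index_add_sweep_even_iff (ι.startQuadrant q₀ i.castSucc)
        (ι.endQuadrant qL i.castSucc)
      have h3 : ¬ (ι.endQuadrant qL i.castSucc = .I ∨ ι.endQuadrant qL i.castSucc = .III) := by
        rw [Itinerary.endQuadrant_castSucc]; split_ifs <;> simp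
      rw [h2] at h3
      rw [hK, targetSector]
      omega
    have hWmem : ∀ σ, W σ ∈ annulus p (μ i.castSucc) (d i.castSucc) (e i.castSucc) ∩
        Quadrant.carrier (if ι.entersFirst i then Quadrant.II else Quadrant.IV) := by
      intro σ
      have hE : energy p (μ i.castSucc) (W σ) = _ := energy_polar hp hμ (hpos σ) _
      refine ⟨⟨by rw [hE]; exact (hmem (r σ)).1.1.1, by rw [hE]; exact (hmem (r σ)).1.1.2⟩, ?_⟩
      rw [← hquad]
      exact polar_mem hp hμ (hpos σ) (hrm σ)
    have hW0 : (W 0).2 = 0 := by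
      simp only [W, polar]
      rw [hr0, gcos_natCast_of_odd hq hodd, mul_zero]
    have hW1 : (W 1).1 = 0 := by
      simp only [W, polar]
      rw [hr1, ← Nat.cast_add_one, gsin_natCast_of_even hq (by omega), mul_zero]
    obtain ⟨ρ, hρ, hρ0, hρ1, hρm⟩ := exists_gap_crossing hp hμ (D.hμ i.succ) (D.hd _) (D.he _)
      (D.hd _) (D.he _) (D.gap i) hW (ι.entersFirst i) hWmem hW0 hW1
    refine ⟨fun σ => drift (t i.succ - s i.castSucc) (W (ρ σ)), ?_, hρ0, hρ1, fun σ =>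
      ⟨hρm σ, ?_⟩⟩
    · have := hW.comp hρ
      simp only [drift]
      fun_prop
    · obtain ⟨hmem', u, v, hpre, hval⟩ := hmem (r (ρ σ))
      obtain ⟨u', v', hsol, hinit, hlap, hgap, hend⟩ := hpre.extend_lap D
        (by rw [hval]; exact hmem') (by rw [hval]; exact hrm (ρ σ))
      rw [hval] at hend
      have hend' : (u' (s i.castSucc), v' (s i.castSucc)) = W (ρ σ) := hend
      obtain ⟨hprod1, hprod2⟩ := gap_products hp hμ (D.hμ i.succ) (D.hd _) (D.he _)
        (D.hd _) (D.he _) (D.gap i) (ι.entersFirst i) (hWmem (ρ σ)) (hρm σ)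
      obtain ⟨u'', v'', hsol', hu, hv, hgap', hend''⟩ := hsol.exists_extend_gap (D.hst i)
        (fun x hx => stepWeight_of_mem_gap D.hts D.hst i hx)
        (by rw [← hend'] at hprod1; exact hprod1) (by rw [← hend'] at hprod2; exact hprod2)
      have hs0 : 0 ≤ s i.castSucc := (D.start_nonneg _).trans (D.hts _).le
      refine ⟨u'', v'', ⟨hsol', ?_, fun j hj => ?_, fun j hj => ?_⟩, by rw [hend'', hend']⟩
      · rw [← hu hs0, ← hv hs0]; exact hinit
      · have hji : j ≤ i.castSucc := Fin.le_castSucc_iff.2 hj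
        refine (hlap j hji).congr (D.hts j).le ?_ hu hv
        rcases hji.eq_or_lt with rfl | hlt
        · exact le_rfl
        · exact ((end_le_start D.hts D.hst hlt).trans (D.hts _)).le
      · rcases hj.eq_or_lt with heq | hlt
        · obtain rfl := Fin.succ_injective _ heq
          exact hgap'
        · have hji : j.succ ≤ i.castSucc := Fin.le_castSucc_iff.2 hlt
          exact (hgap j hji).congr (((strictMono_start D.hts D.hst).monotone hji).trans
            (D.hts _).le) hu hv

theorem exists_solution (D : TwistData m p t s μ d e α β) (hR₀ : IsArcToInfinity R₀)
    (hRL : IsArcToInfinity RL) (hq₀ : R₀ ⊆ q₀.carrier) (hqL : RL ⊆ qL.carrier)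
    (ι : Itinerary m fun i => β i - α i) :
    ∃ u v, SolvesBVP p (stepWeight t s μ) (s (Fin.last m)) R₀ RL u v ∧
      Follows p t s μ d e α β q₀ qL ι u v := by
  obtain ⟨Z, hZ, h0, h1, hmem⟩ := exists_prefix_path (qL := qL) D hR₀ hq₀ ι (Fin.last m)
  have hp := D.hp
  set i := Fin.last m with hi
  have hd := D.hd i
  have he := D.he i
  obtain ⟨Y, hY, hY0, hY1, hYmem⟩ := hRL.exists_path hp (D.hμ i) (lt_min hd he)
    (lt_max_of_lt_left (b := d i) (c := e i) hd)
  have hann : annulus p (μ i) (min (d i) (e i)) (max (d i) (e i)) =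
      annulus p (μ i) (d i) (e i) := by
    simp [annulus]
  obtain ⟨σ, σ', hΘ, hmeet⟩ := exists_meeting hp (D.hμ i) hd he hZ (fun σ => (hmem σ).1.1)
    (D.endAngle_le (q₀ := q₀) (qL := qL) ι i h0) (D.le_endAngle (q₀ := q₀) (qL := qL) ι i h1) hY
    (fun σ => ⟨hann ▸ (hYmem σ).2, by
      rw [clockwiseQuadrant_targetSector, hi, Itinerary.endQuadrant_last]
      exact hqL (hYmem σ).1⟩) hY0 hY1
  obtain ⟨hmem', u, v, hpre, hval⟩ := hmem σ
  obtain ⟨u', v', hsol, hinit, hlap, hgap, hend⟩ := hpre.extend_lap D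
    (by rw [hval]; exact hmem') (by rw [hval]; exact hΘ)
  rw [hval, hmeet] at hend
  refine ⟨u', v', ⟨hsol.isSolution hp ((D.start_nonneg i).trans (D.hts i).le)
    measurable_stepWeight abs_stepWeight_le, hinit, by rw [hend]; exact (hYmem σ').1⟩, ?_⟩
  exact ⟨fun j => (hlap j (Fin.le_last j)).start_mem, fun j => (hlap j (Fin.le_last j)).end_mem,
    fun j => (hlap j (Fin.le_last j)).zeros, fun j => (hgap j (Fin.le_last _)).zeros,
    fun j => (hgap j (Fin.le_last _)).deriv⟩

/-- On a nondegenerate interval the derivative of a solution is determined by the solution. -/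
theorem IsSolution.deriv_eq {a : ℝ → ℝ} {L : ℝ} (hL : 0 < L) {u v u' v' : ℝ → ℝ}
    (h : IsSolution p a L u v) (h' : ∀ x ∈ Icc 0 L, HasDerivWithinAt u' (v' x) (Icc 0 L) x)
    (heq : EqOn u u' (Icc 0 L)) : EqOn v v' (Icc 0 L) := fun x hx =>
  (uniqueDiffOn_Icc hL x hx).eq_deriv _ (h.hasDeriv x hx)
    ((h' x hx).congr (fun _ hy => heq hy) (heq hx))

/-! ### Nontriviality and distinctness of the solutions -/

theorem TwistData.end_le_last (D : TwistData m p t s μ d e α β) (i : Fin (m + 1)) :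
    s i ≤ s (Fin.last m) := by
  rcases (Fin.le_last i).eq_or_lt with rfl | hlt
  · exact le_rfl
  · exact ((end_le_start D.hts D.hst hlt).trans (D.hts _)).le

theorem Follows.not_eqOn_zero (D : TwistData m p t s μ d e α β)
    {ι : Itinerary m fun i => β i - α i} {u v : ℝ → ℝ}
    (h : Follows p t s μ d e α β q₀ qL ι u v)
    (hs : IsSolution p (stepWeight t s μ) (s (Fin.last m)) u v) :
    ¬ EqOn u (fun _ => 0) (Icc 0 (s (Fin.last m))) := by
  intro heq
  have hL : 0 < s (Fin.last m) := (D.start_nonneg _).trans_lt (D.hts _)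
  have hv := hs.deriv_eq hL (v' := fun _ => 0) (fun x _ => hasDerivWithinAt_const _ _ _) heq
  have h0 := annulus_energy_pos (D.hd 0) (D.he 0) (h.start_mem 0).1
  rw [D.ht0, heq ⟨le_rfl, hL.le⟩, hv ⟨le_rfl, hL.le⟩] at h0
  have := energy_zero D.hp (μ 0)
  simp only [Prod.zero_eq_mk] at this
  linarith

/-- Quadrants I and III share only the origin, which no annulus contains, so the phase points at the
times `t i` reveal `entersFirst`. Then the counting intervals and offsets agree, and the zero counts
reveal `lap`. -/
theorem Follows.itinerary_eq (D : TwistData m p t s μ d e α β)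
    {ι ι' : Itinerary m fun i => β i - α i} {u v u' v' : ℝ → ℝ}
    (h : Follows p t s μ d e α β q₀ qL ι u v) (h' : Follows p t s μ d e α β q₀ qL ι' u' v')
    (hs : IsSolution p (stepWeight t s μ) (s (Fin.last m)) u v)
    (hs' : IsSolution p (stepWeight t s μ) (s (Fin.last m)) u' v')
    (heq : EqOn u u' (Icc 0 (s (Fin.last m)))) : ι = ι' := by
  have hL : 0 < s (Fin.last m) := (D.start_nonneg _).trans_lt (D.hts _)
  have hv := hs.deriv_eq hL hs'.hasDeriv heq
  have hti : ∀ i, t i ∈ Icc 0 (s (Fin.last m)) := fun i =>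
    ⟨D.start_nonneg i, (D.hts i).le.trans (D.end_le_last i)⟩
  have hfirst : ι.entersFirst = ι'.entersFirst := by
    funext j
    have h1 := h.start_mem j.succ
    have h2 := h'.start_mem j.succ
    rw [← heq (hti _), ← hv (hti _)] at h2
    have hpos := annulus_energy_pos (D.hd _) (D.he _) h1.1
    have hne : (u (t j.succ), v (t j.succ)) ≠ 0 := by
      intro hz
      rw [hz, energy_zero D.hp] at hpos
      exact lt_irrefl _ hpos
    have h1' := h1.2
    have h2' := h2.2
    rw [Itinerary.startQuadrant_succ] at h1' h2'
    by_contra hb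
    apply hne
    cases hc : ι.entersFirst j <;> cases hc' : ι'.entersFirst j
    · rw [hc, hc'] at hb; exact absurd rfl hb
    · rw [hc] at h1'
      rw [hc'] at h2'
      exact Prod.ext (le_antisymm h1'.1 h2'.1) (le_antisymm h1'.2 h2'.2)
    · rw [hc] at h1'
      rw [hc'] at h2'
      exact Prod.ext (le_antisymm h2'.1 h1'.1) (le_antisymm h2'.2 h1'.2)
    · rw [hc, hc'] at hb; exact absurd rfl hb
  have hlap : ι.lap = ι'.lap := by
    funext j
    have hstart : ι.startQuadrant q₀ j = ι'.startQuadrant q₀ j := by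
      unfold Itinerary.startQuadrant; rw [hfirst]
    have hend : ι.endQuadrant qL j = ι'.endQuadrant qL j := by
      unfold Itinerary.endQuadrant; rw [hfirst]
    have h1 := h.zeros j
    have h2 := h'.zeros j
    rw [← hstart, ← hend] at h2
    have hset : {x ∈ countingInterval (ι.startQuadrant q₀ j) (ι.endQuadrant qL j) (t j) (s j) |
        u x = 0} = {x ∈ countingInterval (ι.startQuadrant q₀ j) (ι.endQuadrant qL j) (t j) (s j) |
        u' x = 0} := by
      ext x
      refine and_congr_right fun hx => ?_
      rw [heq ⟨(D.start_nonneg j).trans hx.1, hx.2.1.trans (D.end_le_last j)⟩]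
    rw [hset, h2] at h1
    have h3 := Nat.cast_injective h1
    exact Fin.ext (by omega)
  cases ι
  cases ι'
  simp only at hfirst hlap
  rw [hfirst, hlap]

end Main

end MooreNehari

theorem theorem7p1 (m : ℕ) (p L : ℝ) (hp : 0 < p) (hp1 : p ≠ 1)
    (t s μ : Fin (m + 1) → ℝ)
    (ht0 : t 0 = 0) (hsL : s (Fin.last m) = L)
    (hts : ∀ i, t i < s i) (hst : ∀ i : Fin m, s i.castSucc < t i.succ)
    (hμ : ∀ i, 0 < μ i)
    (R₀ RL : Set (ℝ × ℝ)) (hR₀ : IsArcToInfinity R₀) (hRL : IsArcToInfinity RL)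
    (q₀ qL : Quadrant) (hq₀ : R₀ ⊆ q₀.carrier) (hqL : RL ⊆ qL.carrier)
    (d e : Fin (m + 1) → ℝ) (hd : ∀ i, 0 < d i) (he : ∀ i, 0 < e i) (hde : ∀ i, d i ≠ e i)
    (α β : Fin (m + 1) → ℕ) (hαβ : ∀ i, α i < β i)
    (twist_inner : ∀ i, i ≠ 0 → i ≠ Fin.last m →
      s i - t i < (α i + 1 / 2) * period p (μ i) (xPlus p (μ i) (d i)) ∧
      (β i + 1 / 2) * period p (μ i) (xPlus p (μ i) (e i)) < s i - t i)
    (twist_outer : ∀ i, i = 0 ∨ i = Fin.last m →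
      s i - t i < (α i + 1 / 4) * period p (μ i) (xPlus p (μ i) (d i)) ∧
      (β i + 1 / 2) * period p (μ i) (xPlus p (μ i) (e i)) < s i - t i)
    (gap : ∀ i : Fin m,
      (xPlus p (μ i.castSucc) (max (d i.castSucc) (e i.castSucc)) +
          xPlus p (μ i.succ) (max (d i.succ) (e i.succ))) /
        √(2 * min (min (d i.castSucc) (e i.castSucc)) (min (d i.succ) (e i.succ)))
        ≤ t i.succ - s i.castSucc) :
    -- at least `2 ^ m * ∏ (β i - α i)` nontrivial solutions, as functions on `[0, L]`
    ((2 ^ m * ∏ i, (β i - α i) : ℕ) : ℕ∞) ≤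
      {w : Set.Icc 0 L → ℝ | w ≠ 0 ∧ ∃ u v : ℝ → ℝ,
        SolvesBVP p (stepWeight t s μ) L R₀ RL u v ∧ (Set.Icc 0 L).domRestrict u = w}.encard ∧
    -- with one solution for each itinerary, distinct itineraries giving distinct solutions
    ∃ U V : Itinerary m (fun i => β i - α i) → ℝ → ℝ,
      (∀ ι, SolvesBVP p (stepWeight t s μ) L R₀ RL (U ι) (V ι) ∧
        Follows p t s μ d e α β q₀ qL ι (U ι) (V ι)) ∧
      Function.Injective fun ι => (Set.Icc 0 L).domRestrict (U ι) := by
  have D : TwistData m p t s μ d e α β :=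
    ⟨hp, ht0, hts, hst, hμ, hd, he, twist_inner, twist_outer, gap⟩
  subst hsL
  have hex := exists_solution D hR₀ hRL hq₀ hqL
  choose U V hUV using hex
  have hinj : Function.Injective fun ι => (Set.Icc 0 (s (Fin.last m))).domRestrict (U ι) := by
    intro ι ι' h
    exact (hUV ι).2.itinerary_eq D (hUV ι').2 (hUV ι).1.1 (hUV ι').1.1
      fun x hx => congrFun h ⟨x, hx⟩
  refine ⟨?_, U, V, hUV, hinj⟩
  rw [← Itinerary.enatCard_eq]
  refine hinj.encard_range.trans (encard_le_encard ?_)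
  rintro _ ⟨ι, rfl⟩
  refine ⟨fun h => ?_, U ι, V ι, (hUV ι).1, rfl⟩
  exact (hUV ι).2.not_eqOn_zero D (hUV ι).1.1 fun x hx => congrFun h ⟨x, hx⟩
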